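/- Let $\mathcal H$ be a finite-dimensional real Hilbert space, $\mathcal Y$ a real Banach space, and let $\xi:\Omega\to\mathbb R^m$ be a random vector on a probability space $(\Omega,\mathcal F,\mathbb P)$ that has a continuous density $f_\xi$ with respect to Lebesgue measure. Let $\mathcal K\subseteq\mathcal Y$ be a nonempty convex cone that is closed or has nonempty interior, with positive polar cone $\mathcal K^+=\{v^*\in\mathcal Y^*:\langle v^*,y\rangle\ge 0\ \forall y\in\mathcal K\}$, and let $\mathcal C\subseteq\mathcal Y^*$ be a convex weak$^*$-compact set with $\operatorname{cl}^{w^*}\operatorname{cone}\mathcal C=\mathcal K^+$. Let $\Phi:\mathcal H\times\mathbb R^m\to\mathcal Y$, and let $h:\mathcal H\to\mathbb R$ be a continuously differentiable convex function such that $(x,z)\mapsto\langle v^*,\Phi(x,z)\rangle+h(x)$ is convex on $\mathcal H\times\mathbb R^m$ for every $v^*\in\mathcal C$. Put $$S(x,z)=\sup_{v^*\in\mathcal C}\big(\langle v^*,\Phi(x,z)\rangle+h(x)\big),\qquad S_\lambda(x,z)=\inf_{(y,w)\in\mathcal H\times\mathbb R^m}\Big(S(y,w)+\tfrac1{2\lambda}\big(\|x-y\|^2+\|z-w\|^2\big)\Big),$$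 $$\varphi(x)=\mathbb P\big(\Phi(x,\xi)\in-\mathcal K\big),\qquad \varphi_\lambda(x)=\mathbb P\big(S_\lambda(x,\xi)\le h(x)\big)\qquad(\lambda>0).$$ For $f:\mathcal H\to\mathbb R$ let $$\partial^{\tt r}f(x)=\Big\{x^*\in\mathcal H:\liminf_{d\to0}\frac{f(x+d)-f(x)-\langle x^*,d\rangle}{\|d\|}\ge0\Big\}$$ be the regular subdifferential, and let the basic subdifferential $\partial^{\tt b}f(x)$ be the set of all limits $x^*=\lim_k x_k^*$ with $x_k^*\in\partial^{\tt r}f(x_k)$, $x_k\to x$ and $f(x_k)\to f(x)$. Let $\bar x\in\mathcal H$ satisfy $S(\bar x,0)<h(\bar x)$, and assume that $\lim_{\|z\|\to\infty}\|z\|^{m+1}f_\xi(z)=0$. Then for every $x^*\in\partial^{\tt r}\varphi(\bar x)$ and every $\varepsilon>0$ there exist $\lambda>0$ and $x_\lambda\in\mathcal H$ such that $\varphi_\lambda$ is differentiable at $x_\lambda$ and $$\|\bar x-x_\lambda\|+\|x^*-\nabla\varphi_\lambda(x_\lambda)\|+|\varphi(\bar x)-\varphi(x_\lambda)|\le\varepsilon.$$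 In particular, $$\partial^{\tt b}\varphi(\bar x)\subseteq\limsup_{x\to\bar x,\ \lambda\to0^+}\{\nabla\varphi_\lambda(x)\},$$ where the right-hand side is the set of all limits of sequences $\nabla\varphi_{\lambda_k}(x_k)$ with $x_k\to\bar x$, $\lambda_k\to0^+$ and $\varphi_{\lambda_k}$ differentiable at $x_k$. -/

import Mathlib

open Set Filter Topology MeasureTheory
open scoped Pointwise

noncomputable section

/-- The Hilbert space `H × ℝ^m`, with `‖(x, z)‖² = ‖x‖² + ‖z‖²`. -/
abbrev JointSpace (H : Type*) (m : ℕ) : Type _ :=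
  WithLp 2 (H × EuclideanSpace ℝ (Fin m))

/-- The point `(x, z)` of `H × ℝ^m`. -/
abbrev jointPoint {H : Type*} {m : ℕ} (x : H) (z : EuclideanSpace ℝ (Fin m)) : JointSpace H m :=
  WithLp.toLp 2 (x, z)

/-- The Moreau envelope `x ↦ inf_z (g z + ‖x - z‖² / (2 lam))`. -/
def moreauEnvelope {E : Type*} [NormedAddCommGroup E] (g : E → ℝ) (lam : ℝ) (x : E) : ℝ :=
  ⨅ z : E, (g z + 1 / (2 * lam) * ‖x - z‖ ^ 2)

/-- The positive polar cone of `K`, in the dual of `Y` with its weak-* topology. -/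
def positivePolar {Y : Type*} [NormedAddCommGroup Y] [NormedSpace ℝ Y] (K : Set Y) :
    Set (WeakDual ℝ Y) :=
  {v | ∀ y ∈ K, 0 ≤ v y}

/-- The cone `{t v : t ≥ 0, v ∈ C}` generated by a (convex) set `C`. -/
def generatedCone {V : Type*} [AddCommGroup V] [Module ℝ V] (C : Set V) : Set V :=
  {w | ∃ t : ℝ, 0 ≤ t ∧ ∃ v ∈ C, w = t • v}

section Setting

variable {H Y Ω : Type*} {m : ℕ}
variable [NormedAddCommGroup Y] [NormedSpace ℝ Y]

/-- The supremum function `S(x, z) = sup {⟨v, Φ(x, z)⟩ + h(x) : v ∈ C}`. -/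
def supremumFunction (Φ : JointSpace H m → Y) (C : Set (WeakDual ℝ Y)) (h : H → ℝ)
    (p : JointSpace H m) : ℝ :=
  sSup ((fun v : WeakDual ℝ Y => v (Φ p) + h p.fst) '' C)

/-- The probability function `φ(x) = P(Φ(x, ξ) ∈ -K)`. -/
def probabilityFunction [MeasurableSpace Ω] (P : Measure Ω)
    (ξ : Ω → EuclideanSpace ℝ (Fin m)) (Φ : JointSpace H m → Y) (K : Set Y) (x : H) : ℝ :=
  P.real {ω | Φ (jointPoint x (ξ ω)) ∈ -K}

/-- The inner regularization `φ_lam(x) = P(e_lam S (x, ξ) ≤ h(x))`, where `e_lam S` is the Moreau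
envelope of the supremum function on the Hilbert space `H × ℝ^m`. -/
def regularizedProbability [NormedAddCommGroup H] [MeasurableSpace Ω] (P : Measure Ω)
    (ξ : Ω → EuclideanSpace ℝ (Fin m)) (Φ : JointSpace H m → Y) (C : Set (WeakDual ℝ Y))
    (h : H → ℝ) (lam : ℝ) (x : H) : ℝ :=
  P.real {ω | moreauEnvelope (supremumFunction Φ C h) lam (jointPoint x (ξ ω)) ≤ h x}

end Setting

section Subdifferentials

variable {H : Type*} [NormedAddCommGroup H] [InnerProductSpace ℝ H]

/-- The regular subdifferential: the `s` with
`liminf_{d → 0} (f(x + d) - f(x) - ⟨s, d⟩) / ‖d‖ ≥ 0`, the lower limit being taken in the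
extended reals. -/
def regularSubdifferential (f : H → ℝ) (x : H) : Set H :=
  {s | 0 ≤ liminf (fun d : H => (((f (x + d) - f x - inner ℝ s d) / ‖d‖ : ℝ) : EReal)) (𝓝[≠] 0)}

/-- The basic subdifferential: the limits of regular subgradients `s k` at points `u k`
such that `u k → x` and `f (u k) → f x`. -/
def basicSubdifferential (f : H → ℝ) (x : H) : Set H :=
  {s₀ | ∃ (u : ℕ → H) (s : ℕ → H), (∀ k, s k ∈ regularSubdifferential f (u k)) ∧
    Tendsto u atTop (𝓝 x) ∧ Tendsto (fun k => f (u k)) atTop (𝓝 (f x)) ∧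
    Tendsto s atTop (𝓝 s₀)}

/-- The outer limit `limsup_{a → l} F(a)` of a set-valued map `F`: the limits of sequences
`g k ∈ F (a k)` with `a k` tending to `l`. -/
def outerLimit {A : Type*} (F : A → Set H) (l : Filter A) : Set H :=
  {s | ∃ (a : ℕ → A) (g : ℕ → H), Tendsto a atTop l ∧ (∀ k, g k ∈ F (a k)) ∧
    Tendsto g atTop (𝓝 s)}

/-- The set `{∇f(x)}`, which is empty where `f` is not differentiable. -/
def gradientSet [CompleteSpace H] (f : H → ℝ) (x : H) : Set H :=
  {g | HasGradientAt f g x}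

end Subdifferentials

end

/-! ### Convex functions in finite dimension and their Moreau envelopes -/

section ConvexFunctions

variable {E : Type*} [NormedAddCommGroup E]

/-! Since `C` is compact and generates the polar cone, separation gives `{S < h} ⊆ {Φ ∈ -K} ⊆ {S ≤
h}`. At a Slater point `x`, where `S (x, 0) < h x`, the slice `{z | S (x, z) = h x}` lies in the
boundary of a convex set and is Lebesgue null, so `φ x` is the probability of `S (x, ξ) ≤ h x`. As
`lam` decreases to `0` the envelopes increase to `S`, so the `φ_lam` are majorants of `φ` that
converge to it at Slater points.

If `s` is a regular subgradient of `φ` at `x`, then `φ_lam - ⟨s, ·⟩` plus a small multiple of `‖· -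
x‖` has a local minimizer near `x` for small `lam`, and the first-order condition there puts the
gradient of `φ_lam` close to `s` (`eventually_exists_hasGradientAt`).

This needs `φ_lam` to be differentiable near Slater points (`differentiableAt_integral_superlevel`).
The envelope is convex and differentiable, so each ray from `0` leaves its sublevel set at radius `1
/ σ`, with `σ` the gauge. In polar coordinates, with `t = 1 / r`, the complementary probability is
an integral over the sphere of `∫ t in 0..σ` of `‖z‖ ^ (m + 1) * f z` at `z = θ / t`. The growth
condition makes this integrand bounded and continuous up to `t = 0`. The gauge is Lipschitz in `x`
uniformly in `θ`, and differentiable where it is positive; where it is zero the integrand vanishes.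
Dominated differentiation concludes. -/

theorem ConvexOn.exists_lower_bound_norm [NormedSpace ℝ E] [FiniteDimensional ℝ E] {g : E → ℝ}
    (hg : ConvexOn ℝ univ g) (p : E) : ∃ B, 0 ≤ B ∧ ∀ z, g p - B * ‖z - p‖ ≤ g z := by
  have hcont : Continuous g := hg.locallyLipschitz.continuous
  have : ProperSpace E := FiniteDimensional.proper ℝ E
  obtain ⟨M, hM⟩ := ((isCompact_closedBall p 1).image hcont).bddAbove
  have hM' : ∀ q ∈ Metric.closedBall p 1, g q ≤ M := fun q hq => hM ⟨q, hq, rfl⟩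
  refine ⟨M - g p, sub_nonneg.2 (hM' p (by simp)), fun z => ?_⟩
  rcases eq_or_ne z p with rfl | hz
  · simp
  have ht : 0 < ‖z - p‖ := norm_pos_iff.2 (sub_ne_zero.2 hz)
  set t := ‖z - p‖ with ht_def
  -- The point at distance one from `p` opposite to `z`: `p` is a convex combination of it and `z`,
  -- so an upper bound for `g` on the unit ball yields a lower bound at `z`.
  have hq : p - t⁻¹ • (z - p) ∈ Metric.closedBall p 1 := by
    simp [Metric.mem_closedBall, norm_smul, ← ht_def, ht.ne', abs_of_pos ht]
  have hsum : 1 / (1 + t) + t / (1 + t) = 1 := by field_simp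
  have hconv := hg.2 (mem_univ z) (mem_univ (p - t⁻¹ • (z - p))) (by positivity)
    (by positivity) hsum
  have hpt : (1 / (1 + t)) • z + (t / (1 + t)) • (p - t⁻¹ • (z - p)) = p := by
    have h1 : (t / (1 + t)) * t⁻¹ = 1 / (1 + t) := by field_simp
    rw [smul_sub, smul_smul, h1, smul_sub]
    calc _ = (1 / (1 + t) + t / (1 + t)) • p := by rw [add_smul]; abel
      _ = p := by rw [hsum, one_smul]
  rw [hpt, smul_eq_mul, smul_eq_mul] at hconv
  have hle := hM' _ hq
  have h2 : (1 + t) * g p ≤ g z + t * g (p - t⁻¹ • (z - p)) := by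
    have := mul_le_mul_of_nonneg_left hconv (by positivity : 0 ≤ 1 + t)
    calc _ ≤ _ := this
      _ = _ := by field_simp
  nlinarith

/-- A function with quadratic expansions has gradients of at most linear growth. -/
theorem exists_norm_le_of_expansion [InnerProductSpace ℝ E] {u : E → ℝ} {M : ℝ} (hM : 0 ≤ M) {w : E → E}
    (hw : ∀ p d, |u (p + d) - u p - inner ℝ (w p) d| ≤ M * ‖d‖ ^ 2) (q : E) :
    ‖w q‖ ≤ ‖w 0‖ + 6 * M * ‖q‖ := by
  have key : ∀ d, ‖d‖ ≤ ‖q‖ → inner ℝ (w q - w 0) d ≤ 6 * M * ‖q‖ ^ 2 := by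
    intro d hd
    -- Three expansions are combined, with remainders `M‖d‖²`, `M‖q + d‖²` and `M‖q‖²`; hence `6 = 1
    -- + 4 + 1`.
    have h1 := (abs_le.1 (hw q d)).1
    have h2 := (abs_le.1 (hw 0 (q + d))).2
    have h3 := (abs_le.1 (hw 0 q)).1
    rw [zero_add] at h2 h3
    rw [inner_add_right] at h2
    rw [inner_sub_left]
    have h4 : ‖d‖ ^ 2 ≤ ‖q‖ ^ 2 := by gcongr
    have h5 : ‖q + d‖ ^ 2 ≤ (2 * ‖q‖) ^ 2 := by
      gcongr; linarith [norm_add_le q d]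
    nlinarith
  have h1 : ‖w q - w 0‖ ≤ 6 * M * ‖q‖ := by
    rcases eq_or_ne (w q - w 0) 0 with h0 | h0
    · rw [h0, norm_zero]; positivity
    rcases eq_or_ne q 0 with rfl | hq0
    · simp
    have hn : 0 < ‖w q - w 0‖ := norm_pos_iff.2 h0
    have hq : 0 < ‖q‖ := norm_pos_iff.2 hq0
    have := key ((‖q‖ / ‖w q - w 0‖) • (w q - w 0)) (by
      rw [norm_smul, Real.norm_of_nonneg (by positivity), div_mul_cancel₀ _ hn.ne'])
    rw [inner_smul_right, real_inner_self_eq_norm_sq] at this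
    have e : ‖q‖ / ‖w q - w 0‖ * ‖w q - w 0‖ ^ 2 = ‖q‖ * ‖w q - w 0‖ := by field_simp
    rw [e] at this
    by_contra! hlt
    nlinarith
  linarith [norm_le_norm_add_norm_sub' (w q) (w 0)]

section Envelope

variable [InnerProductSpace ℝ E] [FiniteDimensional ℝ E] {g : E → ℝ} {lam : ℝ}

/-- Completing the square against a lower bound of slope `B`. The same `B` serves every `lam`, which
gives both the limit `lam → 0` and, through the parameter `2 * lam`, coercivity. -/
theorem ConvexOn.moreau_objective_lower_bound (hg : ConvexOn ℝ univ g) (p : E) :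
    ∃ B, 0 ≤ B ∧ ∀ lam, 0 < lam → ∀ z,
      g p - lam * B ^ 2 / 2 ≤ g z + 1 / (2 * lam) * ‖p - z‖ ^ 2 := by
  obtain ⟨B, hB, h⟩ := hg.exists_lower_bound_norm p
  refine ⟨B, hB, fun lam hlam z => ?_⟩
  have h1 := h z
  rw [norm_sub_rev] at h1
  have h2 : B * ‖p - z‖ ≤ lam * B ^ 2 / 2 + 1 / (2 * lam) * ‖p - z‖ ^ 2 := by
    have : lam * B ^ 2 / 2 + 1 / (2 * lam) * ‖p - z‖ ^ 2 - B * ‖p - z‖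
        = 1 / (2 * lam) * (‖p - z‖ - lam * B) ^ 2 := by field_simp; ring
    have : 0 ≤ 1 / (2 * lam) * (‖p - z‖ - lam * B) ^ 2 := by positivity
    linarith
  linarith

theorem ConvexOn.bddBelow_moreau (hg : ConvexOn ℝ univ g) (hlam : 0 < lam) (p : E) :
    BddBelow (range fun z => g z + 1 / (2 * lam) * ‖p - z‖ ^ 2) := by
  obtain ⟨B, -, h⟩ := hg.moreau_objective_lower_bound p
  exact ⟨_, by rintro _ ⟨z, rfl⟩; exact h lam hlam z⟩

theorem ConvexOn.moreauEnvelope_le_add (hg : ConvexOn ℝ univ g) (hlam : 0 < lam) (p z : E) :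
    moreauEnvelope g lam p ≤ g z + 1 / (2 * lam) * ‖p - z‖ ^ 2 :=
  ciInf_le (hg.bddBelow_moreau hlam p) z

theorem ConvexOn.moreauEnvelope_le (hg : ConvexOn ℝ univ g) (hlam : 0 < lam) (p : E) :
    moreauEnvelope g lam p ≤ g p := by
  simpa using hg.moreauEnvelope_le_add hlam p p

theorem ConvexOn.moreauEnvelope_anti (hg : ConvexOn ℝ univ g) {lam' : ℝ} (hlam : 0 < lam)
    (h : lam ≤ lam') (p : E) : moreauEnvelope g lam' p ≤ moreauEnvelope g lam p := by
  refine ciInf_mono (hg.bddBelow_moreau (hlam.trans_le h) p) fun z => ?_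
  gcongr

theorem ConvexOn.tendsto_moreauEnvelope (hg : ConvexOn ℝ univ g) (p : E) :
    Tendsto (fun lam => moreauEnvelope g lam p) (𝓝[>] 0) (𝓝 (g p)) := by
  obtain ⟨B, -, h⟩ := hg.moreau_objective_lower_bound p
  have hl : Tendsto (fun lam : ℝ => g p - lam * B ^ 2 / 2) (𝓝[>] 0) (𝓝 (g p)) := by
    have : Continuous fun lam : ℝ => g p - lam * B ^ 2 / 2 := by fun_prop
    simpa using (this.tendsto 0).mono_left nhdsWithin_le_nhds
  refine tendsto_of_tendsto_of_tendsto_of_le_of_le' hl tendsto_const_nhds ?_ ?_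
  · filter_upwards [self_mem_nhdsWithin] with lam hlam
    exact le_ciInf (h lam hlam)
  · filter_upwards [self_mem_nhdsWithin] with lam hlam
    exact hg.moreauEnvelope_le hlam p

theorem ConvexOn.exists_moreauEnvelope_eq (hg : ConvexOn ℝ univ g) (hlam : 0 < lam) (p : E) :
    ∃ q, moreauEnvelope g lam p = g q + 1 / (2 * lam) * ‖p - q‖ ^ 2 := by
  have hcont : Continuous g := hg.locallyLipschitz.continuous
  obtain ⟨B, -, h⟩ := hg.moreau_objective_lower_bound p
  have : ProperSpace E := FiniteDimensional.proper ℝ E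
  have hlim : Tendsto (fun z => g z + 1 / (2 * lam) * ‖p - z‖ ^ 2) (cocompact E) atTop := by
    have hnorm : Tendsto (fun z => ‖p - z‖) (cocompact E) atTop := by
      refine tendsto_atTop_mono (fun z => ?_)
        (tendsto_atTop_add_const_right _ (-‖p‖) (tendsto_norm_cocompact_atTop (E := E)))
      have := norm_sub_norm_le z p
      rw [norm_sub_rev] at this
      linarith
    -- Half of the quadratic term pays for the lower bound at parameter `2 * lam`; the other half
    -- tends to infinity.
    have h4 : Tendsto (fun z => g p - (2 * lam) * B ^ 2 / 2 + 1 / (4 * lam) * ‖p - z‖ ^ 2)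
        (cocompact E) atTop :=
      tendsto_atTop_add_const_left _ _
        (((tendsto_pow_atTop two_ne_zero).comp hnorm).const_mul_atTop (by positivity))
    refine tendsto_atTop_mono (fun z => ?_) h4
    have := h (2 * lam) (by positivity) z
    have e : 1 / (2 * lam) * ‖p - z‖ ^ 2
        = 1 / (2 * (2 * lam)) * ‖p - z‖ ^ 2 + 1 / (4 * lam) * ‖p - z‖ ^ 2 := by
      field_simp; ring
    rw [e]; linarith
  obtain ⟨q, hq⟩ := Continuous.exists_forall_le (by fun_prop) hlim
  exact ⟨q, le_antisymm (hg.moreauEnvelope_le_add hlam p q) (le_ciInf hq)⟩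

theorem ConvexOn.convexOn_moreauEnvelope (hg : ConvexOn ℝ univ g) (hlam : 0 < lam) :
    ConvexOn ℝ univ (moreauEnvelope g lam) := by
  refine ⟨convex_univ, fun p _ p' _ a b ha hb hab => ?_⟩
  obtain ⟨q, hq⟩ := hg.exists_moreauEnvelope_eq hlam p
  obtain ⟨q', hq'⟩ := hg.exists_moreauEnvelope_eq hlam p'
  have hsq : ConvexOn ℝ univ fun x : E => ‖x‖ ^ 2 :=
    (convexOn_univ_norm (E := E)).pow (fun _ _ => norm_nonneg _) 2
  have h1 := hsq.2 (mem_univ (p - q)) (mem_univ (p' - q')) ha hb hab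
  have h2 := hg.2 (mem_univ q) (mem_univ q') ha hb hab
  have h3 := hg.moreauEnvelope_le_add hlam (a • p + b • p') (a • q + b • q')
  have e : a • p + b • p' - (a • q + b • q') = a • (p - q) + b • (p' - q') := by
    simp only [smul_sub]; abel
  rw [e] at h3
  simp only [smul_eq_mul] at h1 h2 ⊢
  have h4 := mul_le_mul_of_nonneg_left h1 (by positivity : 0 ≤ 1 / (2 * lam))
  rw [hq, hq']
  linarith

/-- The envelope has at every point a quadratic expansion with an explicit error. -/
theorem ConvexOn.exists_moreauEnvelope_expansion (hg : ConvexOn ℝ univ g) (hlam : 0 < lam)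
    (p : E) : ∃ w : E, ∀ d, |moreauEnvelope g lam (p + d) - moreauEnvelope g lam p - inner ℝ w d|
      ≤ 1 / (2 * lam) * ‖d‖ ^ 2 := by
  obtain ⟨q, hq⟩ := hg.exists_moreauEnvelope_eq hlam p
  -- The proximal point `q` of `p` is used as a competitor at `p + d`.
  have hup : ∀ d, moreauEnvelope g lam (p + d) - moreauEnvelope g lam p
      - inner ℝ (lam⁻¹ • (p - q)) d ≤ 1 / (2 * lam) * ‖d‖ ^ 2 := by
    intro d
    have h1 := hg.moreauEnvelope_le_add hlam (p + d) q
    have e : p + d - q = (p - q) + d := by abel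
    rw [e, norm_add_sq_real] at h1
    rw [hq, inner_smul_left]
    simp only [conj_trivial]
    have e2 : 1 / (2 * lam) * (‖p - q‖ ^ 2 + 2 * inner ℝ (p - q) d + ‖d‖ ^ 2)
        = 1 / (2 * lam) * ‖p - q‖ ^ 2 + lam⁻¹ * inner ℝ (p - q) d + 1 / (2 * lam) * ‖d‖ ^ 2 := by
      field_simp
    linarith
  refine ⟨lam⁻¹ • (p - q), fun d => abs_le.2 ⟨?_, hup d⟩⟩
  -- Since `p` is the midpoint of `p + d` and `p - d`, convexity turns the upper bound at `-d` into
  -- the lower bound at `d`.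
  have h1 := hup (-d)
  have h2 := (hg.convexOn_moreauEnvelope hlam).2 (mem_univ (p + d)) (mem_univ (p + -d))
    (by norm_num : (0 : ℝ) ≤ 1 / 2) (by norm_num : (0 : ℝ) ≤ 1 / 2) (by norm_num)
  have e : (1 / 2 : ℝ) • (p + d) + (1 / 2 : ℝ) • (p + -d) = p := by
    rw [← smul_add, show p + d + (p + -d) = (2 : ℝ) • p by rw [two_smul]; abel, smul_smul]
    norm_num
  rw [e] at h2
  simp only [smul_eq_mul, norm_neg, inner_neg_right] at h1 h2
  linarith

theorem ConvexOn.differentiable_moreauEnvelope (hg : ConvexOn ℝ univ g) (hlam : 0 < lam) :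
    Differentiable ℝ (moreauEnvelope g lam) := by
  intro p
  obtain ⟨w, hw⟩ := hg.exists_moreauEnvelope_expansion hlam p
  have : HasFDerivAt (moreauEnvelope g lam) (innerSL ℝ w) p := by
    rw [hasFDerivAt_iff_isLittleO_nhds_zero]
    refine Asymptotics.IsBigO.trans_isLittleO (g := fun d : E => ‖d‖ ^ 2) ?_ ?_
    · refine Asymptotics.IsBigO.of_bound (1 / (2 * lam)) (Eventually.of_forall fun d => ?_)
      simpa using hw d
    · exact Asymptotics.isLittleO_norm_pow_id one_lt_two
  exact this.differentiableAt

/-- The Lipschitz modulus of the envelope near a point grows at most linearly with the point. -/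
theorem ConvexOn.exists_moreauEnvelope_lipschitz (hg : ConvexOn ℝ univ g) (hlam : 0 < lam) :
    ∃ L, 0 ≤ L ∧ ∀ p q, |moreauEnvelope g lam p - moreauEnvelope g lam q|
      ≤ L * (1 + ‖p‖ + ‖q‖) * ‖p - q‖ := by
  choose w hw using hg.exists_moreauEnvelope_expansion hlam
  have hM : 0 ≤ 1 / (2 * lam) := by positivity
  have hgrow := exists_norm_le_of_expansion hM hw
  set M := 1 / (2 * lam)
  refine ⟨‖w 0‖ + 7 * M, by positivity, fun p q => ?_⟩
  have h1 := hw q (p - q)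
  rw [add_sub_cancel] at h1
  have h2 := abs_real_inner_le_norm (w q) (p - q)
  have h3 := hgrow q
  have h4 : |moreauEnvelope g lam p - moreauEnvelope g lam q|
      ≤ M * ‖p - q‖ ^ 2 + ‖w q‖ * ‖p - q‖ := by
    rw [abs_le] at *
    constructor <;> linarith [h1.1, h1.2, h2.1, h2.2]
  have h5 : ‖p - q‖ ≤ ‖p‖ + ‖q‖ := norm_sub_le p q
  have h6 : M * ‖p - q‖ + ‖w q‖ ≤ (‖w 0‖ + 7 * M) * (1 + ‖p‖ + ‖q‖) := by
    have := mul_le_mul_of_nonneg_left h5 hM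
    nlinarith [norm_nonneg (w 0), norm_nonneg p, norm_nonneg q,
      mul_nonneg (norm_nonneg (w 0)) (norm_nonneg p), mul_nonneg (norm_nonneg (w 0)) (norm_nonneg q),
      mul_nonneg hM (norm_nonneg p), mul_nonneg hM (norm_nonneg q)]
  calc _ ≤ _ := h4
    _ = (M * ‖p - q‖ + ‖w q‖) * ‖p - q‖ := by ring
    _ ≤ _ := by gcongr

end Envelope

end ConvexFunctions

/-! ### Duality between the cone and its compact generator -/

section Cone

variable {Y : Type*} [NormedAddCommGroup Y] [NormedSpace ℝ Y] {K : ConvexCone ℝ Y}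
  {C : Set (WeakDual ℝ Y)}

theorem subset_positivePolar_of_closure_generatedCone
    (hgen : closure (generatedCone C) = positivePolar (K : Set Y)) :
    C ⊆ positivePolar (K : Set Y) := fun v hv =>
  hgen ▸ subset_closure ⟨1, zero_le_one, v, hv, (one_smul ℝ v).symm⟩

theorem nonempty_of_closure_generatedCone
    (hgen : closure (generatedCone C) = positivePolar (K : Set Y)) : C.Nonempty := by
  have h0 : (0 : WeakDual ℝ Y) ∈ positivePolar (K : Set Y) := fun y _ => le_rfl
  rw [← hgen] at h0
  obtain ⟨_, _, _, v, hv, _⟩ := closure_nonempty_iff.1 ⟨_, h0⟩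
  exact ⟨v, hv⟩

theorem bddAbove_image_eval (hC : IsCompact C) (y : Y) (c : ℝ) :
    BddAbove ((fun v : WeakDual ℝ Y => v y + c) '' C) :=
  (hC.image ((WeakDual.eval_continuous y).add continuous_const)).bddAbove

/-- A linear form that is nonnegative on a set stable under positive scalings as soon as it is
bounded below there. -/
theorem nonneg_of_forall_le_of_smul_mem {A : Set Y} (hA : ∀ t : ℝ, 0 < t → ∀ y ∈ A, t • y ∈ A)
    (v : StrongDual ℝ Y) {c : ℝ} (hc : ∀ y ∈ A, c ≤ v y) {y : Y} (hy : y ∈ A) : 0 ≤ v y := by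
  by_contra! hlt
  have h := hc _ (hA (((|c| + 1) / -v y)) (div_pos (by positivity) (by linarith)) y hy)
  rw [map_smul, smul_eq_mul] at h
  have e : (|c| + 1) / -v y * v y = -(|c| + 1) := by
    have : v y ≠ 0 := hlt.ne
    field_simp
  rw [e] at h
  linarith [neg_abs_le c]

/-- If all functionals of a compact generator of the polar cone are nonpositive at `y`, and `K` is
closed, then `y` is in `-K`. -/
theorem mem_neg_of_forall_nonpos (hK_nonempty : (K : Set Y).Nonempty)
    (hgen : closure (generatedCone C) = positivePolar (K : Set Y))
    (hK : IsClosed (K : Set Y)) {y : Y} (hy : ∀ v ∈ C, v y ≤ 0) : y ∈ -(K : Set Y) := by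
  by_contra hmem
  obtain ⟨v, c, hv1, hv2⟩ := geometric_hahn_banach_point_closed K.convex hK hmem
  have hpos : ∀ z ∈ (K : Set Y), 0 ≤ v z := fun z hz =>
    nonneg_of_forall_le_of_smul_mem (fun t ht z hz => K.smul_mem ht hz) v
      (fun z hz => (hv2 z hz).le) hz
  have hvpol : (StrongDual.toWeakDual v) ∈ positivePolar (K : Set Y) := hpos
  have hcl : IsClosed {w : WeakDual ℝ Y | w y ≤ 0} :=
    isClosed_le (WeakDual.eval_continuous y) continuous_const
  have hsub : generatedCone C ⊆ {w : WeakDual ℝ Y | w y ≤ 0} := by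
    rintro _ ⟨t, ht, w, hw, rfl⟩
    exact mul_nonpos_of_nonneg_of_nonpos ht (hy w hw)
  rw [← hgen] at hvpol
  have hvy : v y ≤ 0 := closure_minimal hsub hcl hvpol
  obtain ⟨z, hz⟩ := hK_nonempty
  -- A convex cone need not contain `0`, so `0` is approached along `t • z`.
  have hc : c ≤ 0 := by
    have ht : Tendsto (fun t : ℝ => v (t • z)) (𝓝[>] 0) (𝓝 0) := by
      have : Continuous fun t : ℝ => v (t • z) := by fun_prop
      simpa using (this.tendsto 0).mono_left nhdsWithin_le_nhds
    refine ge_of_tendsto ht ?_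
    filter_upwards [self_mem_nhdsWithin] with t ht
    exact (hv2 _ (K.smul_mem ht hz)).le
  have : v (-y) < c := hv1
  rw [map_neg] at this
  linarith

/-- If all functionals of a compact generator of the polar cone are uniformly negative at `y`, and
`K` has interior points, then `y` is in `-K`. -/
theorem mem_neg_of_forall_neg (hC : IsCompact C)
    (hgen : closure (generatedCone C) = positivePolar (K : Set Y))
    (hK : (interior (K : Set Y)).Nonempty) {y : Y} {δ : ℝ} (hδ : 0 < δ)
    (hy : ∀ v ∈ C, v y ≤ -δ) : y ∈ -(K : Set Y) := by
  by_contra hmem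
  have hmem' : -y ∉ interior (K : Set Y) := fun h =>
    hmem (show -y ∈ (K : Set Y) from interior_subset (s := (K : Set Y)) h)
  obtain ⟨v, hv⟩ := geometric_hahn_banach_point_open K.convex.interior isOpen_interior hmem'
  obtain ⟨k, hk⟩ := hK
  have hsmul : ∀ t : ℝ, 0 < t → ∀ z ∈ interior (K : Set Y), t • z ∈ interior (K : Set Y) := by
    intro t ht z hz
    have h1 : t • z ∈ t • interior (K : Set Y) := smul_mem_smul_set hz
    rw [← interior_smul₀ ht.ne'] at h1
    refine interior_mono ?_ h1
    rintro _ ⟨x, hx, rfl⟩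
    exact K.smul_mem ht hx
  have hint : ∀ z ∈ interior (K : Set Y), 0 ≤ v z := fun z hz =>
    nonneg_of_forall_le_of_smul_mem hsmul v (fun z hz => (hv z hz).le) hz
  have hpos : ∀ z ∈ (K : Set Y), 0 ≤ v z := by
    intro z hz
    have hz' : z ∈ closure (interior (K : Set Y)) :=
      K.convex.closure_interior_eq_closure_of_nonempty_interior ⟨k, hk⟩ ▸ subset_closure hz
    exact closure_minimal (fun z hz => hint z hz)
      (isClosed_le continuous_const v.continuous) hz'
  have hvy : 0 ≤ v y := by
    have ht : Tendsto (fun t : ℝ => v (t • k)) (𝓝[>] 0) (𝓝 0) := by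
      have : Continuous fun t : ℝ => v (t • k) := by fun_prop
      simpa using (this.tendsto 0).mono_left nhdsWithin_le_nhds
    have : v (-y) ≤ 0 := by
      refine ge_of_tendsto ht ?_
      filter_upwards [self_mem_nhdsWithin] with t ht
      exact (hv _ (hsmul t ht k hk)).le
    rw [map_neg] at this
    linarith
  obtain ⟨M, hM⟩ := bddAbove_image_eval hC k 0
  have hM' : ∀ w ∈ C, w k ≤ |M| := fun w hw => by
    have := hM ⟨w, hw, rfl⟩
    simp only [add_zero] at this
    exact this.trans (le_abs_self M)
  -- The bound `w y ≤ -δ` is not stable under scaling. This homogeneous consequence of it and of `w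
  -- k ≤ |M|` is, so it passes to the cone and to its weak-* closure.
  have hcl : IsClosed {w : WeakDual ℝ Y | δ * w k ≤ -(|M| * w y)} :=
    isClosed_le (continuous_const.mul (WeakDual.eval_continuous k))
      (continuous_const.mul (WeakDual.eval_continuous y)).neg
  have hsub : generatedCone C ⊆ {w : WeakDual ℝ Y | δ * w k ≤ -(|M| * w y)} := by
    rintro _ ⟨t, ht, w, hw, rfl⟩
    change δ * (t * w k) ≤ -(|M| * (t * w y))
    have h1 := mul_le_mul_of_nonneg_left (hM' w hw) hδ.le
    have h2 := mul_le_mul_of_nonneg_left (hy w hw) (abs_nonneg M)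
    nlinarith
  have hvpol : (StrongDual.toWeakDual v) ∈ positivePolar (K : Set Y) := hpos
  rw [← hgen] at hvpol
  have h1 : δ * v k ≤ -(|M| * v y) := closure_minimal hsub hcl hvpol
  have hvk : v k ≤ 0 := by
    have : 0 ≤ |M| * v y := by positivity
    by_contra! h
    nlinarith [mul_pos hδ h]
  -- `v` would attain its minimum `0` over `K` at the interior point `k`
  have hzero : v k = 0 := le_antisymm hvk (hint k hk)
  have := hv k hk
  rw [map_neg, hzero] at this
  have hline : Tendsto (fun t : ℝ => k - t • y) (𝓝[>] 0) (𝓝 k) := by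
    have : Continuous fun t : ℝ => k - t • y := by fun_prop
    simpa using (this.tendsto 0).mono_left nhdsWithin_le_nhds
  obtain ⟨t, h1, ht⟩ := ((hline.eventually (isOpen_interior.mem_nhds hk)).and
    self_mem_nhdsWithin).exists
  have h2 := hint _ h1
  rw [map_sub, map_smul, hzero, smul_eq_mul] at h2
  have : 0 < t * v y := mul_pos ht (by linarith)
  linarith

end Cone

/-! ### The supremum function and the constraint -/

section SupremumFunction

variable {H Y : Type*} {m : ℕ} [NormedAddCommGroup Y] [NormedSpace ℝ Y]
  {K : ConvexCone ℝ Y} {C : Set (WeakDual ℝ Y)} {Φ : JointSpace H m → Y} {h : H → ℝ}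

theorem le_supremumFunction (hC : IsCompact C) {v : WeakDual ℝ Y} (hv : v ∈ C)
    (p : JointSpace H m) : v (Φ p) + h p.fst ≤ supremumFunction Φ C h p :=
  le_csSup (bddAbove_image_eval hC _ _) ⟨v, hv, rfl⟩

theorem supremumFunction_le (hC : C.Nonempty) {p : JointSpace H m} {c : ℝ}
    (hc : ∀ v ∈ C, v (Φ p) + h p.fst ≤ c) : supremumFunction Φ C h p ≤ c :=
  csSup_le (hC.image _) (by rintro _ ⟨v, hv, rfl⟩; exact hc v hv)

theorem convexOn_supremumFunction [NormedAddCommGroup H] [InnerProductSpace ℝ H]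
    (hC : IsCompact C) (hC' : C.Nonempty)
    (hΦ : ∀ v ∈ C, ConvexOn ℝ univ (fun p : JointSpace H m => v (Φ p) + h p.fst)) :
    ConvexOn ℝ univ (supremumFunction Φ C h) := by
  refine ⟨convex_univ, fun p _ q _ a b ha hb hab => supremumFunction_le hC' fun v hv => ?_⟩
  refine ((hΦ v hv).2 (mem_univ p) (mem_univ q) ha hb hab).trans ?_
  have h1 := le_supremumFunction (Φ := Φ) (h := h) hC hv p
  have h2 := le_supremumFunction (Φ := Φ) (h := h) hC hv q
  simp only [smul_eq_mul]
  gcongr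

theorem supremumFunction_le_of_mem (hgen : closure (generatedCone C) = positivePolar (K : Set Y))
    {p : JointSpace H m} (hp : Φ p ∈ -(K : Set Y)) : supremumFunction Φ C h p ≤ h p.fst := by
  refine supremumFunction_le (nonempty_of_closure_generatedCone hgen) fun v hv => ?_
  have : 0 ≤ v (-Φ p) := subset_positivePolar_of_closure_generatedCone hgen hv _ hp
  rw [map_neg] at this
  linarith

/-- The strict gap bounds all functionals of `C` at `Φ p` away from zero, as the case of a cone with
interior requires; for a closed cone their sign is enough. -/
theorem mem_of_supremumFunction_lt (hK_nonempty : (K : Set Y).Nonempty)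
    (hK : IsClosed (K : Set Y) ∨ (interior (K : Set Y)).Nonempty) (hC : IsCompact C)
    (hgen : closure (generatedCone C) = positivePolar (K : Set Y))
    {p : JointSpace H m} (hp : supremumFunction Φ C h p < h p.fst) : Φ p ∈ -(K : Set Y) := by
  have hle : ∀ v ∈ C, v (Φ p) ≤ -(h p.fst - supremumFunction Φ C h p) := fun v hv => by
    linarith [le_supremumFunction (Φ := Φ) (h := h) hC hv p]
  rcases hK with hK | hK
  · exact mem_neg_of_forall_nonpos hK_nonempty hgen hK fun v hv => by linarith [hle v hv]
  · exact mem_neg_of_forall_neg hC hgen hK (sub_pos.2 hp) hle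

end SupremumFunction

/-! ### Regular subgradients and smooth majorants -/

section Subgradients

variable {H : Type*} [NormedAddCommGroup H] [InnerProductSpace ℝ H]

theorem eventually_of_mem_regularSubdifferential {φ : H → ℝ} {x s : H}
    (hs : s ∈ regularSubdifferential φ x) {c : ℝ} (hc : 0 < c) :
    ∀ᶠ y in 𝓝 x, φ x + inner ℝ s (y - x) - c * ‖y - x‖ ≤ φ y := by
  have hs' : ((-c : ℝ) : EReal) <
      liminf (fun d : H => (((φ (x + d) - φ x - inner ℝ s d) / ‖d‖ : ℝ) : EReal)) (𝓝[≠] 0) :=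
    lt_of_lt_of_le (by exact_mod_cast neg_lt_zero.2 hc) hs
  have hev := eventually_nhdsWithin_iff.1 (eventually_lt_of_lt_liminf hs')
  have hsub : Tendsto (fun y => y - x) (𝓝 x) (𝓝 0) := by
    have : Continuous fun y : H => y - x := by fun_prop
    simpa using this.tendsto x
  filter_upwards [hsub.eventually hev] with y hy
  rcases eq_or_ne y x with rfl | hne
  · simp
  have hpos : 0 < ‖y - x‖ := norm_pos_iff.2 (sub_ne_zero.2 hne)
  have h1 := EReal.coe_lt_coe_iff.1 (hy (sub_ne_zero.2 hne))
  rw [add_sub_cancel, lt_div_iff₀ hpos] at h1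
  linarith

/-- First-order condition at a local minimizer of `ψ - ⟨s, ·⟩ + c ‖· - x‖`. -/
theorem HasGradientAt.norm_sub_le_of_eventually [CompleteSpace H] {ψ : H → ℝ} {x g s : H} {c : ℝ}
    (hc : 0 ≤ c) (hg : HasGradientAt ψ g x)
    (hmin : ∀ᶠ y in 𝓝 x, ψ x - c * ‖y - x‖ ≤ ψ y - inner ℝ s (y - x)) :
    ‖s - g‖ ≤ c := by
  refine le_of_forall_pos_le_add fun η hη => ?_
  rw [hasGradientAt_iff_isLittleO] at hg
  have hev := (hg.def hη).and hmin
  have hline : Tendsto (fun t : ℝ => x + t • (s - g)) (𝓝[>] 0) (𝓝 x) := by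
    have : Continuous fun t : ℝ => x + t • (s - g) := by fun_prop
    simpa using (this.tendsto 0).mono_left nhdsWithin_le_nhds
  obtain ⟨t, ⟨h1, h2⟩, ht⟩ := ((hline.eventually hev).and self_mem_nhdsWithin).exists
  have ht : 0 < t := ht
  rw [add_sub_cancel_left, norm_smul, Real.norm_of_nonneg ht.le, inner_smul_right] at h1 h2
  have h3 := (abs_le.1 h1).2
  have h4 : inner ℝ s (s - g) - inner ℝ g (s - g) = ‖s - g‖ ^ 2 := by
    rw [← inner_sub_left, real_inner_self_eq_norm_sq]
  by_contra! hlt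
  have hn : 0 < t * ‖s - g‖ := mul_pos ht (by linarith)
  have : t * ‖s - g‖ ^ 2 ≤ (c + η) * (t * ‖s - g‖) := by rw [← h4]; linarith
  nlinarith

/-- Regular subgradients of `φ` are approximated by gradients of majorants of `φ` that are
differentiable near `x` and converge to `φ` at `x`. -/
theorem eventually_exists_hasGradientAt [FiniteDimensional ℝ H] [CompleteSpace H] {ι : Type*}
    {l : Filter ι} {φ : H → ℝ} {ψ : ι → H → ℝ} {x s : H} (hs : s ∈ regularSubdifferential φ x)
    (hle : ∀ᶠ i in l, ∀ y, φ y ≤ ψ i y) (hlim : Tendsto (fun i => ψ i x) l (𝓝 (φ x)))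
    {δ : ℝ} (hδ : 0 < δ)
    (hdiff : ∀ᶠ i in l, ∀ y ∈ Metric.ball x δ, DifferentiableAt ℝ (ψ i) y) {ε : ℝ} (hε : 0 < ε) :
    ∀ᶠ i in l, ∃ y g, HasGradientAt (ψ i) g y ∧ ‖x - y‖ + ‖s - g‖ + |φ x - φ y| ≤ ε := by
  have : ProperSpace H := FiniteDimensional.proper ℝ H
  obtain ⟨c, hc, hcε⟩ : ∃ c, 0 < c ∧ c = ε / 4 := ⟨_, by positivity, rfl⟩
  obtain ⟨r₁, hr₁, hsub⟩ := Metric.eventually_nhds_iff.1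
    (eventually_of_mem_regularSubdifferential hs hc)
  -- The gradient error is at most `2 * c = ε / 2`; the distance and the change of `φ` are together
  -- at most `r * A ≤ ε / 2`.
  set A := 1 + ‖s‖ + c with hA
  have hApos : 0 < A := by positivity
  obtain ⟨r, hr, hrδ, hrr₁, hrε⟩ : ∃ r, 0 < r ∧ r < δ ∧ r < r₁ ∧ r * A ≤ ε / 2 := by
    refine ⟨min (min (δ / 2) (r₁ / 2)) (ε / 2 / A), by positivity, ?_, ?_, ?_⟩
    · exact (min_le_left _ _).trans_lt ((min_le_left _ _).trans_lt (by linarith))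
    · exact (min_le_left _ _).trans_lt ((min_le_right _ _).trans_lt (by linarith))
    · exact (le_div_iff₀ hApos).1 (min_le_right _ _)
  have hnear : ∀ᶠ i in l, ψ i x < φ x + c * r :=
    hlim.eventually_lt_const (by linarith [mul_pos hc hr])
  filter_upwards [hle, hdiff, hnear] with i hle hdiff hnear
  have hcont : ContinuousOn (fun y => ψ i y - inner ℝ s (y - x) + 2 * c * ‖y - x‖)
      (Metric.closedBall x r) := by
    have h1 : ContinuousOn (ψ i) (Metric.closedBall x r) := fun y hy =>
      (hdiff y (Metric.closedBall_subset_ball hrδ hy)).continuousAt.continuousWithinAt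
    fun_prop
  obtain ⟨y, hy, hymin⟩ := (isCompact_closedBall x r).exists_isMinOn ⟨x, by simp [hr.le]⟩ hcont
  have hymin : ∀ z ∈ Metric.closedBall x r, ψ i y - inner ℝ s (y - x) + 2 * c * ‖y - x‖
      ≤ ψ i z - inner ℝ s (z - x) + 2 * c * ‖z - x‖ := hymin
  have hyr : ‖y - x‖ ≤ r := by simpa [dist_eq_norm] using hy
  have h1 := hymin x (by simp [hr.le])
  rw [sub_self, inner_zero_right, norm_zero] at h1
  have h2 := hsub (y := y) (by rw [dist_eq_norm]; linarith)
  have h3 := hle y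
  -- The penalty has slope `2 * c`, of which the subgradient inequality consumes `c`. The rest gives
  -- `c * ‖y - x‖ < c * r`, so the minimizer is interior.
  have hyr' : ‖y - x‖ < r := by
    by_contra! hge
    nlinarith
  refine ⟨y, gradient (ψ i) y,
    (hdiff y (by rw [Metric.mem_ball, dist_eq_norm]; linarith)).hasGradientAt, ?_⟩
  have hg := (hdiff y (by rw [Metric.mem_ball, dist_eq_norm]; linarith)).hasGradientAt
  have h4 : ‖s - gradient (ψ i) y‖ ≤ 2 * c := by
    refine HasGradientAt.norm_sub_le_of_eventually (by positivity) hg ?_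
    filter_upwards [Metric.isOpen_ball.mem_nhds (show y ∈ Metric.ball x r by
      rwa [Metric.mem_ball, dist_eq_norm])] with z hz
    have h5 := hymin z (Metric.ball_subset_closedBall hz)
    have h6 : ‖z - x‖ ≤ ‖z - y‖ + ‖y - x‖ := norm_sub_le_norm_sub_add_norm_sub z y x
    have h7 : inner ℝ s (z - x) = inner ℝ s (z - y) + inner ℝ s (y - x) := by
      rw [← inner_add_right, sub_add_sub_cancel]
    rw [h7] at h5
    nlinarith
  have h5 := abs_real_inner_le_norm s (y - x)
  have h6 : ‖s‖ * ‖y - x‖ ≤ ‖s‖ * r := by gcongr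
  have h7 : |φ x - φ y| ≤ ‖s‖ * r + c * r := by
    have h8 : c * ‖y - x‖ ≤ c * r := by gcongr
    have h9 : 0 ≤ c * ‖y - x‖ := by positivity
    rw [abs_le] at h5 ⊢
    constructor <;> linarith [h5.1, h5.2]
  rw [norm_sub_rev x y]
  have h8 : r * A = r + ‖s‖ * r + c * r := by rw [hA]; ring
  linarith

end Subgradients

/-! ### Gauges of convex sublevel sets -/

section SublevelGauge

theorem sublevel_zero_mem_nhds {E : Type*} [NormedAddCommGroup E] {u : E → ℝ}
    (hcont : Continuous u) (h0 : u 0 < 0) :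
    {z | u z ≤ 0} ∈ 𝓝 0 :=
  mem_of_superset ((isOpen_Iio.preimage hcont).mem_nhds h0) fun z hz =>
    show u z ≤ 0 from le_of_lt hz

variable {E : Type*} [NormedAddCommGroup E] [NormedSpace ℝ E] {u u' : E → ℝ}

theorem convex_sublevel_zero (hu : ConvexOn ℝ univ u) : Convex ℝ {z | u z ≤ 0} := by
  simpa using hu.convex_le 0

theorem gauge_sublevel_le_one_iff (hu : ConvexOn ℝ univ u) (hcont : Continuous u) (h0 : u 0 < 0)
    {z : E} : gauge {z | u z ≤ 0} z ≤ 1 ↔ u z ≤ 0 := by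
  rw [gauge_le_one_iff_mem_closure (convex_sublevel_zero hu) (sublevel_zero_mem_nhds hcont h0),
    (isClosed_le hcont continuous_const).closure_eq, mem_ofPred_eq]

theorem eq_zero_of_gauge_sublevel_eq_one (hu : ConvexOn ℝ univ u) (hcont : Continuous u)
    (h0 : u 0 < 0) {z : E} (hz : gauge {z | u z ≤ 0} z = 1) : u z = 0 := by
  refine le_antisymm ((gauge_sublevel_le_one_iff hu hcont h0).1 hz.le) ?_
  by_contra! hlt
  have hmem : z ∈ interior {z | u z ≤ 0} :=
    interior_maximal (fun z hz => show u z ≤ 0 from le_of_lt hz) (isOpen_Iio.preimage hcont) hlt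
  have := (gauge_lt_one_iff_mem_interior (convex_sublevel_zero hu)
    (sublevel_zero_mem_nhds hcont h0)).2 hmem
  exact this.ne hz

/-- Perturbation bound for gauges of sublevel sets of convex functions. -/
theorem gauge_sublevel_le_add (hu : ConvexOn ℝ univ u) (hcont : Continuous u) (h0 : u 0 < 0)
    (hu' : ConvexOn ℝ univ u') {c D : ℝ} (hc : 0 < c) (h0' : u' 0 ≤ -c) (hD : 0 ≤ D)
    (h : ∀ z, u' z ≤ u z + D * (1 + ‖z‖)) {θ : E} (hθ : ‖θ‖ = 1) :
    gauge {z | u' z ≤ 0} θ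
      ≤ gauge {z | u z ≤ 0} θ + D / c * (gauge {z | u z ≤ 0} θ + 1) := by
  set σ := gauge {z | u z ≤ 0} θ with hσ
  have hσ0 : 0 ≤ σ := gauge_nonneg _
  have key : ∀ s > σ, gauge {z | u' z ≤ 0} θ ≤ s + D / c * (s + 1) := by
    intro s hs
    have hs0 : 0 < s := hσ0.trans_lt hs
    have h1 : u (s⁻¹ • θ) ≤ 0 := by
      rw [← gauge_sublevel_le_one_iff hu hcont h0,
        gauge_smul_of_nonneg (inv_nonneg.2 hs0.le), smul_eq_mul, ← hσ]
      rw [inv_mul_le_iff₀ hs0]; linarith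
    have h2 := h (s⁻¹ • θ)
    rw [norm_smul, hθ, mul_one, norm_inv, Real.norm_of_nonneg hs0.le] at h2
    have hb : 0 < s + D / c * (s + 1) := by positivity
    have he : 0 ≤ D * (1 + s⁻¹) := by positivity
    set e := D * (1 + s⁻¹) with he_def
    -- At `s⁻¹ • θ` the value of `u'` is at most `e`, at `0` at most `-c`. These weights balance the
    -- two, and the shrunk point keeps `u' ≤ 0`.
    have h3 := hu'.2 (mem_univ (s⁻¹ • θ)) (mem_univ 0)
      (by positivity : 0 ≤ c / (c + e)) (by positivity : 0 ≤ e / (c + e)) (by field_simp)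
    rw [smul_zero, add_zero, smul_smul, smul_eq_mul, smul_eq_mul] at h3
    have h4 : c / (c + e) * u' (s⁻¹ • θ) + e / (c + e) * u' 0 ≤ 0 := by
      have : c / (c + e) * u' (s⁻¹ • θ) + e / (c + e) * u' 0
          ≤ c / (c + e) * e + e / (c + e) * (-c) := by gcongr; linarith
      refine this.trans (le_of_eq ?_)
      field_simp; ring
    have h5 : c / (c + e) * s⁻¹ = (s + D / c * (s + 1))⁻¹ := by
      rw [he_def]; field_simp
    rw [h5] at h3
    exact gauge_le_of_mem hb.le
      ((mem_smul_set_iff_inv_smul_mem₀ hb.ne' _ _).2 (h3.trans h4))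
  have hlim : Tendsto (fun s => s + D / c * (s + 1)) (𝓝[>] σ) (𝓝 (σ + D / c * (σ + 1))) := by
    have : Continuous fun s : ℝ => s + D / c * (s + 1) := by fun_prop
    exact (this.tendsto σ).mono_left nhdsWithin_le_nhds
  refine ge_of_tendsto hlim ?_
  filter_upwards [self_mem_nhdsWithin] with s hs using key s hs

theorem exists_gauge_sublevel_le (hcont : Continuous u) (h0 : u 0 < 0) :
    ∃ R, 0 ≤ R ∧ ∀ θ : E, ‖θ‖ = 1 → gauge {z | u z ≤ 0} θ ≤ R := by
  obtain ⟨r, hr, hball⟩ := Metric.mem_nhds_iff.1 (sublevel_zero_mem_nhds hcont h0)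
  refine ⟨r⁻¹, by positivity, fun θ hθ => ?_⟩
  have := mul_gauge_le_norm hball (x := θ)
  rw [hθ] at this
  rwa [← one_div, le_div_iff₀ hr, mul_comm]

/-- A positive radial derivative at the boundary of the sublevel set. -/
theorem deriv_neg_of_gauge_pos (hu : ConvexOn ℝ univ u) (hcont : Continuous u) (h0 : u 0 < 0)
    {θ : E} (hσ : 0 < gauge {z | u z ≤ 0} θ) {b : ℝ}
    (hb : HasDerivAt (fun t : ℝ => u (t⁻¹ • θ)) b (gauge {z | u z ≤ 0} θ)) : b < 0 := by
  set σ := gauge {z | u z ≤ 0} θ with hσ_def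
  have hconv : ConvexOn ℝ univ fun r : ℝ => u (r • θ) := by
    exact hu.comp_linearMap (LinearMap.toSpanSingleton ℝ E θ)
  have hr : HasDerivAt (fun r : ℝ => u (r • θ)) (b * -(σ⁻¹ ^ 2)⁻¹) σ⁻¹ := by
    have h1 : HasDerivAt (fun r : ℝ => r⁻¹) (-(σ⁻¹ ^ 2)⁻¹) σ⁻¹ :=
      hasDerivAt_inv (inv_ne_zero hσ.ne')
    have h2 : HasDerivAt (fun t : ℝ => u (t⁻¹ • θ)) b (σ⁻¹)⁻¹ := by rwa [inv_inv]
    simpa [Function.comp_def] using h2.comp σ⁻¹ h1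
  have hzero : u (σ⁻¹ • θ) = 0 := eq_zero_of_gauge_sublevel_eq_one hu hcont h0 (by
    rw [gauge_smul_of_nonneg (by positivity), ← hσ_def, smul_eq_mul, inv_mul_cancel₀ hσ.ne'])
  -- The convex function `r ↦ u (r • θ)` rises from `u 0 < 0` to `0` at `σ⁻¹`, so its slope there is
  -- positive; `t = r⁻¹` reverses the sign.
  have h3 := hconv.slope_le_of_hasDerivAt (mem_univ 0) (mem_univ σ⁻¹) (inv_pos.2 hσ) hr
  rw [slope_def_field, zero_smul, hzero, zero_sub, sub_zero] at h3
  have h4 : 0 < -u 0 / σ⁻¹ := div_pos (by linarith) (by positivity)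
  have h5 : 0 < (σ⁻¹ ^ 2)⁻¹ := by positivity
  by_contra! hb0
  nlinarith

end SublevelGauge

/-! ### Implicit differentiation at a single point -/

section Implicit

variable {H : Type*} [NormedAddCommGroup H] [NormedSpace ℝ H]

/-- Since `σ` is already given with a Lipschitz bound at `x₀`, differentiability of `F` at one point
suffices: its first-order expansion along the graph of `σ` is solved for `σ x - σ x₀`. -/
theorem hasFDerivAt_of_isBigO_of_implicit {F : H × ℝ → ℝ} {F' : H × ℝ →L[ℝ] ℝ} {σ : H → ℝ} {x₀ : H}
    (hF : HasFDerivAt F F' (x₀, σ x₀))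
    (hσ : (fun x => σ x - σ x₀) =O[𝓝 x₀] fun x => x - x₀)
    (hzero : ∀ᶠ x in 𝓝 x₀, F (x, σ x) = F (x₀, σ x₀)) (hne : F' (0, 1) ≠ 0) :
    HasFDerivAt σ (-(F' (0, 1))⁻¹ • F'.comp (ContinuousLinearMap.inl ℝ H ℝ)) x₀ := by
  have hσ0 : Tendsto σ (𝓝 x₀) (𝓝 (σ x₀)) := by
    have h1 : Tendsto (fun x => x - x₀) (𝓝 x₀) (𝓝 0) := by
      have : Continuous fun x : H => x - x₀ := by fun_prop
      simpa using this.tendsto x₀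
    simpa using (hσ.trans_tendsto h1).add_const (σ x₀)
  have hpair : Tendsto (fun x => (x, σ x)) (𝓝 x₀) (𝓝 (x₀, σ x₀)) := tendsto_id.prodMk_nhds hσ0
  have hO : (fun x => (x, σ x) - (x₀, σ x₀)) =O[𝓝 x₀] fun x => x - x₀ :=
    (Asymptotics.isBigO_refl _ _).prod_left hσ
  have h1 := (hF.isLittleO.comp_tendsto hpair).trans_isBigO hO
  rw [hasFDerivAt_iff_isLittleO]
  have h2 := h1.const_mul_left (-(F' (0, 1))⁻¹)
  refine (Asymptotics.IsLittleO.congr' h2 ?_ EventuallyEq.rfl)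
  filter_upwards [hzero] with x hx
  have e : F' ((x, σ x) - (x₀, σ x₀)) = F' (x - x₀, 0) + (σ x - σ x₀) * F' (0, 1) := by
    rw [← smul_eq_mul, ← map_smul, ← map_add]
    simp
  simp only [Function.comp_apply, hx, e, sub_self, smul_apply,
    ContinuousLinearMap.comp_apply, ContinuousLinearMap.inl_apply, smul_eq_mul]
  field_simp
  ring

/-- The derivative of `x ↦ ∫_0^{σ x} k`, where `σ` needs not be differentiable at the points where
the integrand vanishes. -/
theorem differentiableAt_integral_upper {k : ℝ → ℝ} (hk : Continuous k) {σ : H → ℝ} {x₀ : H}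
    (hσ : (fun x => σ x - σ x₀) =O[𝓝 x₀] fun x => x - x₀)
    (hσ' : k (σ x₀) = 0 ∨ DifferentiableAt ℝ σ x₀) :
    DifferentiableAt ℝ (fun x => ∫ t in (0 : ℝ)..σ x, k t) x₀ := by
  have hd : HasDerivAt (fun s => ∫ t in (0 : ℝ)..s, k t) (k (σ x₀)) (σ x₀) :=
    intervalIntegral.integral_hasDerivAt_right (hk.intervalIntegrable _ _)
      (hk.stronglyMeasurableAtFilter _ _) hk.continuousAt
  rcases hσ' with h0 | h
  · have hσ0 : Tendsto σ (𝓝 x₀) (𝓝 (σ x₀)) := by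
      have h1 : Tendsto (fun x => x - x₀) (𝓝 x₀) (𝓝 0) := by
        have : Continuous fun x : H => x - x₀ := by fun_prop
        simpa using this.tendsto x₀
      simpa using (hσ.trans_tendsto h1).add_const (σ x₀)
    have h1 := ((hasDerivAt_iff_isLittleO.1 hd).comp_tendsto hσ0).trans_isBigO hσ
    have : HasFDerivAt (fun x => ∫ t in (0 : ℝ)..σ x, k t) (0 : H →L[ℝ] ℝ) x₀ := by
      rw [hasFDerivAt_iff_isLittleO]
      simpa [Function.comp_def, h0] using h1
    exact this.differentiableAt
  · exact hd.differentiableAt.comp x₀ h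

end Implicit

/-! ### Polar coordinates and the density along rays -/

section RadialIntegration

variable {E : Type*} [NormedAddCommGroup E] [NormedSpace ℝ E] [FiniteDimensional ℝ E]
  [MeasurableSpace E] [BorelSpace E] [Nontrivial E] (μ : Measure E) [μ.IsAddHaarMeasure]

/-- Integration in polar coordinates. -/
theorem integral_eq_integral_toSphere {F : E → ℝ} (hF : Integrable F μ) :
    Integrable (fun θ : Metric.sphere (0 : E) 1 => ∫ r : Ioi (0 : ℝ), F (r.1 • θ.1)
        ∂Measure.volumeIoiPow (Module.finrank ℝ E - 1)) μ.toSphere ∧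
      ∫ z, F z ∂μ = ∫ θ : Metric.sphere (0 : E) 1, ∫ r : Ioi (0 : ℝ), F (r.1 • θ.1)
        ∂Measure.volumeIoiPow (Module.finrank ℝ E - 1) ∂μ.toSphere := by
  have hmp := μ.measurePreserving_homeomorphUnitSphereProd
  have hemb : MeasurableEmbedding (homeomorphUnitSphereProd E) := Homeomorph.measurableEmbedding _
  set F' : Metric.sphere (0 : E) 1 × Ioi (0 : ℝ) → ℝ := fun q => F (q.2.1 • q.1.1) with hF'
  have hcomp : F' ∘ homeomorphUnitSphereProd E = fun z : ({0}ᶜ : Set E) => F z.1 := by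
    funext z
    have h := (homeomorphUnitSphereProd E).symm_apply_apply z
    have h2 : ((homeomorphUnitSphereProd E).symm (homeomorphUnitSphereProd E z)).1 = z.1 := by
      rw [h]
    rw [homeomorphUnitSphereProd_symm_apply_coe] at h2
    simp only [hF', Function.comp_apply, h2]
  have hint : Integrable F' (μ.toSphere.prod (Measure.volumeIoiPow (Module.finrank ℝ E - 1))) := by
    rw [← hmp.integrable_comp_emb hemb, hcomp]
    have : IntegrableOn F ({0}ᶜ : Set E) μ := hF.integrableOn
    rwa [integrableOn_iff_comap_subtypeVal (measurableSet_singleton _).compl] at this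
  refine ⟨hint.integral_prod_left, ?_⟩
  calc ∫ z, F z ∂μ = ∫ z : ({0}ᶜ : Set E), F z.1 ∂(μ.comap Subtype.val) := by
        rw [integral_subtype_comap (measurableSet_singleton _).compl F,
          restrict_compl_singleton]
    _ = ∫ q, F' q ∂μ.toSphere.prod (Measure.volumeIoiPow (Module.finrank ℝ E - 1)) := by
        rw [← hmp.integral_comp hemb F', ← hcomp]
        rfl
    _ = _ := integral_prod _ hint

end RadialIntegration

section RadialDensity

variable {E : Type*} [NormedAddCommGroup E] [NormedSpace ℝ E] {Q : E → ℝ}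

/-- The integral over a ray outside `{r | r σ ≤ 1}`, after the substitution `t = 1 / r`. -/
theorem integral_ray_eq_intervalIntegral (f : E → ℝ) (n : ℕ) {θ : E} (hθ : ‖θ‖ = 1) {σ : ℝ}
    (hσ : 0 ≤ σ) :
    ∫ r : Ioi (0 : ℝ), (if 1 < r.1 * σ then f (r.1 • θ) else 0) ∂Measure.volumeIoiPow n
      = ∫ t in (0 : ℝ)..σ, ‖t⁻¹ • θ‖ ^ (n + 2) * f (t⁻¹ • θ) := by
  simp only [Measure.volumeIoiPow, ENNReal.ofReal]
  rw [integral_withDensity_eq_integral_smul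
      ((measurable_subtype_coe.pow_const _).real_toNNReal),
    integral_subtype_comap measurableSet_Ioi fun r : ℝ => Real.toNNReal (r ^ n) •
      (if 1 < r * σ then f (r • θ) else 0),
    ← integral_comp_rpow_Ioi _ (by norm_num : (-1 : ℝ) ≠ 0),
    intervalIntegral.integral_of_le hσ, ← integral_Ioc_eq_integral_Ioo.symm]
  have : Ioo 0 σ = Ioi 0 ∩ Iio σ := rfl
  rw [this, ← setIntegral_indicator measurableSet_Iio]
  refine setIntegral_congr_fun measurableSet_Ioi fun t ht => ?_
  have ht : 0 < t := ht
  have hn : ‖t⁻¹ • θ‖ = t⁻¹ := by rw [norm_smul, hθ, mul_one, Real.norm_of_nonneg (by positivity)]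
  -- The Jacobian of `r = t⁻¹` adds two to the exponent `n` of the radial measure.
  have hr : t ^ ((-1 : ℝ) - 1) = t⁻¹ ^ 2 := by
    rw [show ((-1 : ℝ) - 1) = -((2 : ℕ) : ℝ) by norm_num, Real.rpow_neg ht.le, Real.rpow_natCast,
      inv_pow]
  rw [Real.rpow_neg_one, hr, NNReal.smul_def,
    Real.coe_toNNReal _ (by positivity)]
  have hiff : 1 < t⁻¹ * σ ↔ t ∈ Iio σ := by
    rw [← div_eq_inv_mul, one_lt_div ht]; rfl
  by_cases h : t ∈ Iio σ
  · rw [indicator_of_mem h, if_pos (hiff.2 h), hn]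
    simp only [smul_eq_mul]
    norm_num
    ring
  · rw [indicator_of_notMem h, if_neg (mt hiff.1 h)]
    simp

/-- The value `t = 0` stands for the end of the ray at infinity. With the convention `0⁻¹ = 0` the
function takes there the value `Q 0 = 0`, which is its limit. -/
theorem continuous_comp_inv_smul (hQ : Continuous Q) (h0 : Q 0 = 0)
    (hlim : Tendsto Q (Bornology.cobounded E) (𝓝 0)) {θ : E} (hθ : ‖θ‖ = 1) :
    Continuous fun t : ℝ => Q (t⁻¹ • θ) := by
  refine continuous_iff_continuousAt.2 fun t => ?_
  rcases eq_or_ne t 0 with rfl | ht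
  · rw [continuousAt_iff_punctured_nhds]
    simp only [inv_zero, zero_smul, h0]
    refine hlim.comp ?_
    rw [← tendsto_norm_atTop_iff_cobounded]
    simpa [norm_smul, hθ, Function.comp_def] using
      tendsto_norm_cobounded_atTop.comp (tendsto_inv₀_nhdsNE_zero (α := ℝ))
  · have : ContinuousAt (fun t : ℝ => t⁻¹ • θ) t := (continuousAt_inv₀ ht).smul continuousAt_const
    exact hQ.continuousAt.comp this

theorem exists_abs_le_of_tendsto_cobounded {E : Type*} [NormedAddCommGroup E]
    [ProperSpace E] {Q : E → ℝ} (hQ : Continuous Q)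
    (hlim : Tendsto Q (Bornology.cobounded E) (𝓝 0)) : ∃ M, 0 ≤ M ∧ ∀ z, |Q z| ≤ M := by
  have h1 : ∀ᶠ z in Bornology.cobounded E, |Q z| < 1 := by
    have := hlim.abs
    rw [abs_zero] at this
    exact this.eventually_lt_const one_pos
  rw [Metric.cobounded_eq_cocompact] at h1
  obtain ⟨S, hS, hSc⟩ := mem_cocompact.1 h1
  obtain ⟨M, hM⟩ := (hS.image hQ.abs).bddAbove
  refine ⟨max M 1, by positivity, fun z => ?_⟩
  by_cases hz : z ∈ S
  · exact (hM ⟨z, hz, rfl⟩).trans (le_max_left _ _)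
  · exact (le_of_lt (hSc hz)).trans (le_max_right _ _)

end RadialDensity

/-! ### Measurability of derivatives in a parameter -/

section MeasurabilityOfDerivatives

variable {α H : Type*} [MeasurableSpace α] {ν : Measure α} [NormedAddCommGroup H]
  [InnerProductSpace ℝ H] [FiniteDimensional ℝ H]

/-- Directional derivatives are limits of sequences of measurable difference quotients; an
orthonormal basis assembles them into the full derivative. -/
theorem aestronglyMeasurable_of_hasFDerivAt {e : H → α → ℝ} {e' : α → H →L[ℝ] ℝ} {x₀ : H}
    (hmeas : ∀ᶠ x in 𝓝 x₀, AEStronglyMeasurable (e x) ν)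
    (h : ∀ a, HasFDerivAt (fun x => e x a) (e' a) x₀) : AEStronglyMeasurable e' ν := by
  have hdir : ∀ v : H, AEStronglyMeasurable (fun a => e' a v) ν := by
    intro v
    have hc : Tendsto (fun n : ℕ => ((n : ℝ) + 1)⁻¹) atTop (𝓝[≠] 0) :=
      tendsto_nhdsWithin_iff.2 ⟨by simpa using tendsto_one_div_add_atTop_nhds_zero_nat (𝕜 := ℝ),
        Eventually.of_forall fun n => by
          have : (n : ℝ) + 1 ≠ 0 := by positivity
          simpa using this⟩
    have hx : Tendsto (fun n : ℕ => x₀ + ((n : ℝ) + 1)⁻¹ • v) atTop (𝓝 x₀) := by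
      have : Continuous fun t : ℝ => x₀ + t • v := by fun_prop
      simpa [Function.comp_def] using (this.tendsto 0).comp (hc.mono_right nhdsWithin_le_nhds)
    obtain ⟨N, hN⟩ := eventually_atTop.1 (hx.eventually hmeas)
    refine aestronglyMeasurable_of_tendsto_ae atTop
      (f := fun n a => (((n + N : ℕ) : ℝ) + 1)⁻¹⁻¹ •
        (e (x₀ + (((n + N : ℕ) : ℝ) + 1)⁻¹ • v) a - e x₀ a)) (fun n => ?_)
      (Eventually.of_forall fun a => ?_)
    · exact ((hN (n + N) (by lia)).sub hmeas.self_of_nhds).const_smul ((((n + N : ℕ) : ℝ) + 1)⁻¹⁻¹)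
    · exact ((h a).hasLineDerivAt v).tendsto_slope_zero.comp (hc.comp (tendsto_add_atTop_nat N))
  let b := stdOrthonormalBasis ℝ H
  have hsum : e' = fun a => ∑ i, e' a (b i) • innerSL ℝ (b i) := by
    funext a
    ext v
    conv_lhs => rw [← b.sum_repr' v, map_sum]
    simp [mul_comm]
  rw [hsum]
  exact Finset.aestronglyMeasurable_fun_sum _ fun i _ => (hdir (b i)).smul_const _

end MeasurabilityOfDerivatives

/-! ### Differentiating the integral over a moving superlevel set -/

section DerivativeOfMeasure

variable {H E : Type*} [NormedAddCommGroup H] [NormedAddCommGroup E] [NormedSpace ℝ E] {G : H → E → ℝ} {x₀ : H}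

/-- The gauge of the sublevel set `{G x ≤ 0}` is Lipschitz in `x` at `x₀`, uniformly over the
unit sphere. -/
theorem exists_gauge_sublevel_lipschitz (hconv : ∀ x, ConvexOn ℝ univ (G x))
    (hcont : ∀ x, Continuous (G x)) (h0 : G x₀ 0 < 0) {L : ℝ} (hL : 0 ≤ L)
    (hLip : ∀ᶠ x in 𝓝 x₀, ∀ z, |G x z - G x₀ z| ≤ L * (1 + ‖z‖) * ‖x - x₀‖) :
    ∃ B, 0 ≤ B ∧ ∀ᶠ x in 𝓝 x₀, G x 0 < 0 ∧ ∀ θ : E, ‖θ‖ = 1 →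
      |gauge {z | G x z ≤ 0} θ - gauge {z | G x₀ z ≤ 0} θ| ≤ B * ‖x - x₀‖ := by
  obtain ⟨R, hR, hσR⟩ := exists_gauge_sublevel_le (hcont x₀) h0
  -- Half of the slack at `x₀`: then `G x 0 ≤ -c` for nearby `x`, and the gauge perturbation bound
  -- applies in both directions.
  obtain ⟨c, hc, hc0⟩ : ∃ c, 0 < c ∧ G x₀ 0 = -(2 * c) := ⟨-(G x₀ 0) / 2, by linarith, by ring⟩
  have hsmall : ∀ᶠ x in 𝓝 x₀, L * ‖x - x₀‖ < c := by
    have : Continuous fun x => L * ‖x - x₀‖ := by fun_prop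
    exact (this.tendsto x₀).eventually_lt_const (by simpa using hc)
  refine ⟨L / c * (2 * R + 2), by positivity, ?_⟩
  filter_upwards [hLip, hsmall] with x hx hsmall
  have hxc : G x 0 ≤ -c := by
    have := (abs_le.1 (hx 0)).2
    rw [norm_zero, add_zero, mul_one] at this
    linarith
  have hD : 0 ≤ L * ‖x - x₀‖ := by positivity
  refine ⟨by linarith, fun θ hθ => ?_⟩
  have h1 := gauge_sublevel_le_add (hconv x₀) (hcont x₀) h0 (hconv x) hc hxc hD
    (fun z => by have := (abs_le.1 (hx z)).2; linarith) hθ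
  have h2 := gauge_sublevel_le_add (hconv x) (hcont x) (by linarith) (hconv x₀) hc
    (by linarith : G x₀ 0 ≤ -c) hD
    (fun z => by have := (abs_le.1 (hx z)).1; linarith) hθ
  have h3 := hσR θ hθ
  set σ := gauge {z | G x z ≤ 0} θ
  set σ₀ := gauge {z | G x₀ z ≤ 0} θ
  have hq : L * ‖x - x₀‖ / c ≤ 1 := by rw [div_le_one hc]; exact hsmall.le
  have hq0 : 0 ≤ L * ‖x - x₀‖ / c := by positivity
  have e : L / c * (2 * R + 2) * ‖x - x₀‖ = L * ‖x - x₀‖ / c * (2 * R + 2) := by ring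
  have hσ₀ : 0 ≤ σ₀ := gauge_nonneg _
  have hσ : σ ≤ 2 * R + 1 := by nlinarith
  have h4 : L * ‖x - x₀‖ / c * (σ₀ + 1) ≤ L * ‖x - x₀‖ / c * (2 * R + 2) :=
    mul_le_mul_of_nonneg_left (by linarith) hq0
  have h5 : L * ‖x - x₀‖ / c * (σ + 1) ≤ L * ‖x - x₀‖ / c * (2 * R + 2) :=
    mul_le_mul_of_nonneg_left (by linarith) hq0
  rw [e, abs_le]
  constructor <;> linarith

variable [InnerProductSpace ℝ H]

/-- A positive gauge `σ x` solves `G x ((σ x)⁻¹ • θ) = 0`, and convexity with the Slater condition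
makes the derivative in the radial variable nonzero. -/
theorem differentiableAt_gauge_sublevel (hconv : ∀ x, ConvexOn ℝ univ (G x))
    (hcont : ∀ x, Continuous (G x)) (hneg : ∀ᶠ x in 𝓝 x₀, G x 0 < 0)
    (hdiff : ∀ z, DifferentiableAt ℝ (fun q : H × E => G q.1 q.2) (x₀, z)) {θ : E}
    (hθ : (fun x => gauge {z | G x z ≤ 0} θ - gauge {z | G x₀ z ≤ 0} θ) =O[𝓝 x₀] fun x => x - x₀)
    (hσ : 0 < gauge {z | G x₀ z ≤ 0} θ) :
    DifferentiableAt ℝ (fun x => gauge {z | G x z ≤ 0} θ) x₀ := by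
  set σ : H → ℝ := fun x => gauge {z | G x z ≤ 0} θ with hσ_def
  have hσ : 0 < σ x₀ := hσ
  have h0 := hneg.self_of_nhds
  have hinv : DifferentiableAt ℝ (fun q : H × ℝ => q.2⁻¹) (x₀, σ x₀) :=
    differentiableAt_snd.fun_inv hσ.ne'
  have hinner : DifferentiableAt ℝ (fun q : H × ℝ => (q.1, q.2⁻¹ • θ)) (x₀, σ x₀) :=
    differentiableAt_fst.prodMk (hinv.smul_const θ)
  have hF : DifferentiableAt ℝ (fun q : H × ℝ => G q.1 (q.2⁻¹ • θ)) (x₀, σ x₀) :=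
    DifferentiableAt.comp (g := fun q : H × E => G q.1 q.2) (x₀, σ x₀)
      (hdiff ((σ x₀)⁻¹ • θ)) hinner
  have hzero : ∀ x, G x 0 < 0 → 0 < σ x → G x ((σ x)⁻¹ • θ) = 0 := fun x hx hs =>
    eq_zero_of_gauge_sublevel_eq_one (hconv x) (hcont x) hx (by
      rw [gauge_smul_of_nonneg (by positivity), smul_eq_mul]
      exact inv_mul_cancel₀ hs.ne')
  have hpos : ∀ᶠ x in 𝓝 x₀, 0 < σ x := by
    have h1 : Tendsto (fun x => x - x₀) (𝓝 x₀) (𝓝 0) := by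
      have : Continuous fun x : H => x - x₀ := by fun_prop
      simpa using this.tendsto x₀
    have h2 := (hθ.trans_tendsto h1).add_const (σ x₀)
    rw [zero_add] at h2
    exact (h2.congr fun x => sub_add_cancel (σ x) _).eventually_const_lt hσ
  refine (hasFDerivAt_of_isBigO_of_implicit hF.hasFDerivAt hθ ?_ ?_).differentiableAt
  · filter_upwards [hneg, hpos] with x h1 h2
    rw [hzero x h1 h2, hzero x₀ h0 hσ]
  · have hline : HasDerivAt (fun t : ℝ => ((x₀, t) : H × ℝ)) (0, 1) (σ x₀) :=
      (hasDerivAt_const _ _).prodMk (hasDerivAt_id _)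
    exact (deriv_neg_of_gauge_pos (hconv x₀) (hcont x₀) h0 hσ
      (hF.hasFDerivAt.comp_hasDerivAt (σ x₀) hline)).ne

variable [FiniteDimensional ℝ H] [FiniteDimensional ℝ E] [MeasurableSpace E] [BorelSpace E]
  [Nontrivial E] {μ : Measure E} [μ.IsAddHaarMeasure]

/-- The integral of `f` over the superlevel set of a convex function, by rays. -/
theorem integral_superlevel_eq {u f : E → ℝ} (hu : ConvexOn ℝ univ u) (h0 : u 0 < 0)
    (hf : Integrable f μ) :
    Integrable (fun θ : Metric.sphere (0 : E) 1 =>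
        ∫ t in (0 : ℝ)..gauge {z | u z ≤ 0} θ.1,
          ‖t⁻¹ • θ.1‖ ^ (Module.finrank ℝ E + 1) * f (t⁻¹ • θ.1)) μ.toSphere ∧
      ∫ z in {z | 0 < u z}, f z ∂μ = ∫ θ : Metric.sphere (0 : E) 1,
        (∫ t in (0 : ℝ)..gauge {z | u z ≤ 0} θ.1,
          ‖t⁻¹ • θ.1‖ ^ (Module.finrank ℝ E + 1) * f (t⁻¹ • θ.1)) ∂μ.toSphere := by
  have hcont : Continuous u := hu.locallyLipschitz.continuous
  have hmeas : MeasurableSet {z | 0 < u z} := (isOpen_lt continuous_const hcont).measurableSet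
  have hrays : ∀ θ : Metric.sphere (0 : E) 1,
      ∫ r : Ioi (0 : ℝ), {z | 0 < u z}.indicator f (r.1 • θ.1)
        ∂Measure.volumeIoiPow (Module.finrank ℝ E - 1)
      = ∫ t in (0 : ℝ)..gauge {z | u z ≤ 0} θ.1,
          ‖t⁻¹ • θ.1‖ ^ (Module.finrank ℝ E + 1) * f (t⁻¹ • θ.1) := by
    intro θ
    have hpos : 0 < Module.finrank ℝ E := Module.finrank_pos
    have hray := integral_ray_eq_intervalIntegral f (Module.finrank ℝ E - 1)
      (by simp : ‖θ.1‖ = 1) (gauge_nonneg (s := {z | u z ≤ 0}) θ.1)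
    rw [show Module.finrank ℝ E - 1 + 2 = Module.finrank ℝ E + 1 by lia] at hray
    rw [← hray]
    refine integral_congr_ae (Eventually.of_forall fun r => ?_)
    have hr : 0 < r.1 := r.2
    have hiff : 1 < r.1 * gauge {z | u z ≤ 0} θ.1 ↔ r.1 • θ.1 ∈ {z | 0 < u z} := by
      rw [← smul_eq_mul, ← gauge_smul_of_nonneg hr.le, ← not_le,
        gauge_sublevel_le_one_iff hu hcont h0, not_le, mem_ofPred_eq]
    beta_reduce
    by_cases h : r.1 • θ.1 ∈ {z | 0 < u z}
    · rw [indicator_of_mem h, if_pos (hiff.2 h)]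
    · rw [indicator_of_notMem h, if_neg (mt hiff.1 h)]
  have hpolar := integral_eq_integral_toSphere μ (hf.indicator hmeas)
  simp only [hrays] at hpolar
  rwa [integral_indicator hmeas] at hpolar

/-- Differentiability of the integral of a density over a parametrized convex superlevel set. -/
theorem differentiableAt_integral_superlevel {f : E → ℝ} (hf_cont : Continuous f)
    (hf : Integrable f μ)
    (hf_growth : Tendsto (fun z => ‖z‖ ^ (Module.finrank ℝ E + 1) * f z)
      (Bornology.cobounded E) (𝓝 0))
    (hconv : ∀ x, ConvexOn ℝ univ (G x)) (h0 : G x₀ 0 < 0) {L : ℝ} (hL : 0 ≤ L)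
    (hLip : ∀ᶠ x in 𝓝 x₀, ∀ z, |G x z - G x₀ z| ≤ L * (1 + ‖z‖) * ‖x - x₀‖)
    (hdiff : ∀ z, DifferentiableAt ℝ (fun q : H × E => G q.1 q.2) (x₀, z)) :
    DifferentiableAt ℝ (fun x => ∫ z in {z | 0 < G x z}, f z ∂μ) x₀ := by
  have hcont : ∀ x, Continuous (G x) := fun x => (hconv x).locallyLipschitz.continuous
  obtain ⟨B, hB, hσ⟩ := exists_gauge_sublevel_lipschitz hconv hcont h0 hL hLip
  set Q : E → ℝ := fun z => ‖z‖ ^ (Module.finrank ℝ E + 1) * f z with hQ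
  have hQ_cont : Continuous Q := by fun_prop
  have hQ0 : Q 0 = 0 := by simp [hQ]
  have : ProperSpace E := FiniteDimensional.proper ℝ E
  obtain ⟨M, hM, hQM⟩ := exists_abs_le_of_tendsto_cobounded hQ_cont hf_growth
  set e : H → Metric.sphere (0 : E) 1 → ℝ := fun x θ =>
    ∫ t in (0 : ℝ)..gauge {z | G x z ≤ 0} θ.1, Q (t⁻¹ • θ.1) with he
  have hnorm : ∀ θ : Metric.sphere (0 : E) 1, ‖θ.1‖ = 1 := fun θ => by simp
  have hk : ∀ θ : Metric.sphere (0 : E) 1, Continuous fun t : ℝ => Q (t⁻¹ • θ.1) := fun θ =>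
    continuous_comp_inv_smul hQ_cont hQ0 hf_growth (hnorm θ)
  have hrep : ∀ x, G x 0 < 0 → Integrable (e x) μ.toSphere ∧
      ∫ z in {z | 0 < G x z}, f z ∂μ = ∫ θ, e x θ ∂μ.toSphere := fun x hx =>
    integral_superlevel_eq (hconv x) hx hf
  have hdiff_e : ∀ θ, DifferentiableAt ℝ (fun x => e x θ) x₀ := by
    intro θ
    have hO : (fun x => gauge {z | G x z ≤ 0} θ.1 - gauge {z | G x₀ z ≤ 0} θ.1)
        =O[𝓝 x₀] fun x => x - x₀ :=
      Asymptotics.IsBigO.of_bound B (hσ.mono fun x hx => hx.2 θ.1 (hnorm θ))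
    refine differentiableAt_integral_upper (hk θ) hO ?_
    -- On a ray that stays in the sublevel set the gauge is zero and may fail to be differentiable
    -- in `x`, but the integrand vanishes at `t = 0`.
    rcases (gauge_nonneg (s := {z | G x₀ z ≤ 0}) θ.1).eq_or_lt with h | h
    · left
      rw [← h, inv_zero, zero_smul, hQ0]
    · exact Or.inr (differentiableAt_gauge_sublevel hconv hcont (hσ.mono fun x hx => hx.1) hdiff
        hO h)
  have hmain := hasFDerivAt_integral_of_dominated_loc_of_lip' (μ := μ.toSphere) (F := e)
    (F' := fun θ => fderiv ℝ (fun x => e x θ) x₀) (bound := fun _ => M * B) hσ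
    (fun x hx => (hrep x hx.1).1.aestronglyMeasurable) (hrep x₀ h0).1
    (aestronglyMeasurable_of_hasFDerivAt
      (hσ.mono fun x hx => (hrep x hx.1).1.aestronglyMeasurable)
      fun θ => (hdiff_e θ).hasFDerivAt)
    (Eventually.of_forall fun θ x hx => ?_) (integrable_const _)
    (Eventually.of_forall fun θ => (hdiff_e θ).hasFDerivAt)
  · refine hmain.2.differentiableAt.congr_of_eventuallyEq ?_
    filter_upwards [hσ] with x hx using (hrep x hx.1).2
  · have h1 : e x θ - e x₀ θ = ∫ t in gauge {z | G x₀ z ≤ 0} θ.1..gauge {z | G x z ≤ 0} θ.1,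
        Q (t⁻¹ • θ.1) :=
      intervalIntegral.integral_interval_sub_left ((hk θ).intervalIntegrable _ _)
        ((hk θ).intervalIntegrable _ _)
    rw [h1, mul_assoc]
    refine (intervalIntegral.norm_integral_le_of_norm_le_const fun t _ => hQM _).trans ?_
    gcongr
    exact hx.2 θ.1 (hnorm θ)

end DerivativeOfMeasure

/-! ### The law of the random vector and null boundaries -/

section RandomVector

variable {Ω E : Type*} [MeasurableSpace Ω] {P : Measure Ω} [IsProbabilityMeasure P]
  [MeasurableSpace E] {μ : Measure E} {ξ : Ω → E} {f : E → ℝ}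

theorem integrable_of_map_eq_withDensity (hξ : Measurable ξ) (hf : Measurable f)
    (hf_nonneg : ∀ z, 0 ≤ f z) (h : P.map ξ = μ.withDensity fun z => ENNReal.ofReal (f z)) :
    Integrable f μ := by
  have : IsProbabilityMeasure (P.map ξ) := Measure.isProbabilityMeasure_map hξ.aemeasurable
  refine ⟨hf.aestronglyMeasurable, ?_⟩
  rw [hasFiniteIntegral_iff_ofReal (Eventually.of_forall hf_nonneg)]
  have h1 : (P.map ξ) univ = 1 := measure_univ
  rw [h, withDensity_apply _ MeasurableSet.univ, Measure.restrict_univ] at h1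
  rw [h1]
  exact ENNReal.one_lt_top

theorem measureReal_preimage_sublevel_eq [TopologicalSpace E]
    [OpensMeasurableSpace E] (hξ : Measurable ξ) (hf : Measurable f)
    (hf_nonneg : ∀ z, 0 ≤ f z) (h : P.map ξ = μ.withDensity fun z => ENNReal.ofReal (f z))
    {u : E → ℝ} (hu : Continuous u) :
    P.real {ω | u (ξ ω) ≤ 0} = 1 - ∫ z in {z | 0 < u z}, f z ∂μ := by
  have : IsProbabilityMeasure (P.map ξ) := Measure.isProbabilityMeasure_map hξ.aemeasurable
  have hmeas : MeasurableSet {z | 0 < u z} := (isOpen_lt continuous_const hu).measurableSet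
  have hcompl : {ω | u (ξ ω) ≤ 0} = (ξ ⁻¹' {z | 0 < u z})ᶜ := by
    ext ω; simp
  have hint := integrable_of_map_eq_withDensity hξ hf hf_nonneg h
  rw [hcompl, probReal_compl_eq_one_sub (hξ hmeas), ← map_measureReal_apply hξ hmeas, h,
    measureReal_def, withDensity_apply _ hmeas,
    ← ofReal_integral_eq_lintegral_ofReal hint.integrableOn (Eventually.of_forall hf_nonneg),
    ENNReal.toReal_ofReal (integral_nonneg hf_nonneg)]

end RandomVector

section SublevelBoundary

variable {E : Type*} [NormedAddCommGroup E] [NormedSpace ℝ E] [FiniteDimensional ℝ E]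
  [MeasurableSpace E] [BorelSpace E] (μ : Measure E) [μ.IsAddHaarMeasure]

/-- The Slater point at `0` prevents a zero of `u` from being interior to the sublevel set, and the
frontier of a convex set is null. -/
theorem ConvexOn.measure_eq_zero_of_slater {u : E → ℝ} (hu : ConvexOn ℝ univ u)
    (h0 : u 0 < 0) : μ {z | u z = 0} = 0 := by
  have hcont : Continuous u := hu.locallyLipschitz.continuous
  refine measure_mono_null (fun z hz => ?_) ((convex_sublevel_zero hu).addHaar_frontier μ)
  have hz : u z = 0 := hz
  refine ⟨subset_closure (show u z ≤ 0 from hz.le), fun hint => ?_⟩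
  have hlt := (gauge_lt_one_iff_mem_interior (convex_sublevel_zero hu)
    (sublevel_zero_mem_nhds hcont h0)).2 hint
  -- a point with gauge less than one is a proper convex combination of `0` and a sublevel point
  obtain ⟨b, hb0, hb1, y, hy, rfl⟩ := exists_lt_of_gauge_lt
    (absorbent_nhds_zero (sublevel_zero_mem_nhds hcont h0)) hlt
  have hy : u y ≤ 0 := hy
  have h1 := hu.2 (mem_univ y) (mem_univ 0) hb0.le (sub_nonneg.2 hb1.le) (by ring)
  simp only [smul_zero, add_zero, smul_eq_mul] at h1
  rw [hz] at h1
  nlinarith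

end SublevelBoundary

/-! ### The product Hilbert space -/

section JointSpace

variable {H : Type*} [NormedAddCommGroup H] {m : ℕ}

theorem norm_jointPoint_sub_left (x y : H) (z : EuclideanSpace ℝ (Fin m)) :
    ‖jointPoint x z - jointPoint y z‖ = ‖x - y‖ := by
  rw [← WithLp.toLp_sub, Prod.mk_sub_mk, sub_self, WithLp.prod_norm_eq_of_L2]
  simp

theorem norm_jointPoint_le (x : H) (z : EuclideanSpace ℝ (Fin m)) :
    ‖jointPoint x z‖ ≤ ‖x‖ + ‖z‖ := by
  rw [WithLp.prod_norm_eq_of_L2]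
  refine Real.sqrt_le_iff.2 ⟨by positivity, ?_⟩
  change ‖x‖ ^ 2 + ‖z‖ ^ 2 ≤ _
  nlinarith [norm_nonneg x, norm_nonneg z, mul_nonneg (norm_nonneg x) (norm_nonneg z)]

variable [InnerProductSpace ℝ H]

theorem differentiable_jointPoint :
    Differentiable ℝ fun q : H × EuclideanSpace ℝ (Fin m) => jointPoint q.1 q.2 :=
  (WithLp.prodContinuousLinearEquiv 2 ℝ H (EuclideanSpace ℝ (Fin m))).symm.differentiable

theorem ConvexOn.comp_jointPoint_sub_const {g : JointSpace H m → ℝ} (hg : ConvexOn ℝ univ g)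
    (x : H) (c : ℝ) :
    ConvexOn ℝ univ fun z : EuclideanSpace ℝ (Fin m) => g (jointPoint x z) - c := by
  refine ⟨convex_univ, fun z _ z' _ a b ha hb hab => ?_⟩
  have h := hg.2 (mem_univ (jointPoint x z)) (mem_univ (jointPoint x z')) ha hb hab
  have e : jointPoint x (a • z + b • z') = a • jointPoint x z + b • jointPoint x z' := by
    conv_lhs => rw [← one_smul ℝ x, ← hab, add_smul]
    rfl
  beta_reduce
  rw [e]
  simp only [smul_eq_mul] at h ⊢
  have : c = a * c + b * c := by rw [← add_mul, hab, one_mul]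
  linarith

end JointSpace

/-! ### The probability functions at Slater points -/

section Probability

variable {H : Type*} [NormedAddCommGroup H] [InnerProductSpace ℝ H]
  {Ω : Type*} [MeasurableSpace Ω] {P : Measure Ω} [IsProbabilityMeasure P] {m : ℕ}
  {ξ : Ω → EuclideanSpace ℝ (Fin m)} {f : EuclideanSpace ℝ (Fin m) → ℝ}
  {g : JointSpace H m → ℝ} {h : H → ℝ}

/-- The event `Φ ∈ -K` lies between `{g < h}` and `{g ≤ h}`, which differ by a null set. Only
monotonicity and subadditivity are applied to it, so its measurability plays no role. -/
theorem probabilityFunction_eq_measureReal {Y : Type*} [NormedAddCommGroup Y] {K : Set Y}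
    {Φ : JointSpace H m → Y} (hξ : Measurable ξ)
    (hf_density : P.map ξ = volume.withDensity fun z => ENNReal.ofReal (f z))
    (hg : ConvexOn ℝ univ g) (hle : ∀ p, Φ p ∈ -K → g p ≤ h p.fst)
    (hlt : ∀ p, g p < h p.fst → Φ p ∈ -K) {x : H} (hx : g (jointPoint x 0) < h x) :
    probabilityFunction P ξ Φ K x = P.real {ω | g (jointPoint x (ξ ω)) ≤ h x} := by
  refine le_antisymm (measureReal_mono fun ω hω => hle _ hω) ?_
  have hu := hg.comp_jointPoint_sub_const x (h x)
  have hcont := hu.locallyLipschitz.continuous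
  have hnull : P {ω | g (jointPoint x (ξ ω)) - h x = 0} = 0 := by
    have hac : P.map ξ ≪ volume := hf_density ▸ withDensity_absolutelyContinuous _ _
    have h1 := hac (hu.measure_eq_zero_of_slater volume (sub_neg.2 hx))
    rwa [Measure.map_apply hξ (isClosed_eq hcont continuous_const).measurableSet] at h1
  calc P.real {ω | g (jointPoint x (ξ ω)) ≤ h x}
      ≤ P.real ({ω | Φ (jointPoint x (ξ ω)) ∈ -K} ∪ {ω | g (jointPoint x (ξ ω)) - h x = 0}) := by
        refine measureReal_mono fun ω hω => ?_
        rcases (show g (jointPoint x (ξ ω)) ≤ h x from hω).lt_or_eq with h1 | h1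
        · exact Or.inl (hlt _ h1)
        · exact Or.inr (sub_eq_zero.2 h1)
    _ ≤ P.real {ω | Φ (jointPoint x (ξ ω)) ∈ -K}
        + P.real {ω | g (jointPoint x (ξ ω)) - h x = 0} := measureReal_union_le _ _
    _ = probabilityFunction P ξ Φ K x := by
        rw [measureReal_def (s := {ω | g (jointPoint x (ξ ω)) - h x = 0}), hnull,
          ENNReal.toReal_zero, add_zero]
        rfl

variable [FiniteDimensional ℝ H]

/-- Differentiability of the probability of the sublevel event of the envelope at Slater points. -/
theorem differentiableAt_measureReal_moreauEnvelope (hξ : Measurable ξ) (hf_cont : Continuous f)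
    (hf_nonneg : ∀ z, 0 ≤ f z)
    (hf_density : P.map ξ = volume.withDensity fun z => ENNReal.ofReal (f z))
    (hf_growth : Tendsto (fun z => ‖z‖ ^ (m + 1) * f z)
      (Bornology.cobounded (EuclideanSpace ℝ (Fin m))) (𝓝 0))
    (hg : ConvexOn ℝ univ g) (hh : Differentiable ℝ h) {lam : ℝ} (hlam : 0 < lam) {x₀ : H}
    (hx₀ : g (jointPoint x₀ 0) < h x₀) :
    DifferentiableAt ℝ
      (fun x => P.real {ω | moreauEnvelope g lam (jointPoint x (ξ ω)) ≤ h x}) x₀ := by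
  have hS := hg.convexOn_moreauEnvelope hlam
  have hSd := hg.differentiable_moreauEnvelope hlam
  have hx₀' : moreauEnvelope g lam (jointPoint x₀ 0) < h x₀ :=
    (hg.moreauEnvelope_le hlam _).trans_lt hx₀
  -- Polar coordinates need a nontrivial space. For `m = 0` the probability is one near the Slater
  -- point.
  rcases Nat.eq_zero_or_pos m with rfl | hm
  · have hcont : Continuous fun x => moreauEnvelope g lam (jointPoint x 0) :=
      hSd.continuous.comp (differentiable_jointPoint.continuous.comp
        (continuous_id.prodMk continuous_const))
    have hev : ∀ᶠ x in 𝓝 x₀, moreauEnvelope g lam (jointPoint x 0) < h x :=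
      (isOpen_lt hcont hh.continuous).mem_nhds hx₀'
    refine (differentiableAt_const (1 : ℝ)).congr_of_eventuallyEq ?_
    filter_upwards [hev] with x hx
    have : {ω | moreauEnvelope g lam (jointPoint x (ξ ω)) ≤ h x} = univ :=
      eq_univ_of_forall fun ω => by
        change moreauEnvelope g lam (jointPoint x (ξ ω)) ≤ h x
        rw [Subsingleton.elim (ξ ω) 0]
        exact hx.le
    rw [this, probReal_univ]
  have : Nonempty (Fin m) := ⟨⟨0, hm⟩⟩
  have hconv : ∀ x, ConvexOn ℝ univ fun z : EuclideanSpace ℝ (Fin m) =>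
      moreauEnvelope g lam (jointPoint x z) - h x := fun x => hS.comp_jointPoint_sub_const x (h x)
  have hrep : ∀ x, P.real {ω | moreauEnvelope g lam (jointPoint x (ξ ω)) ≤ h x}
      = 1 - ∫ z in {z | 0 < moreauEnvelope g lam (jointPoint x z) - h x}, f z := fun x => by
    rw [← measureReal_preimage_sublevel_eq hξ hf_cont.measurable hf_nonneg hf_density
      (hconv x).locallyLipschitz.continuous]
    simp only [sub_nonpos]
  simp only [hrep]
  refine DifferentiableAt.const_sub ?_ 1
  obtain ⟨L, hL, hLip⟩ := hg.exists_moreauEnvelope_lipschitz hlam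
  obtain ⟨D, hD, hhD⟩ := (hh x₀).isBigO_sub.exists_pos
  refine differentiableAt_integral_superlevel (L := L * (2 + 2 * ‖x₀‖) + D)
    (G := fun x z => moreauEnvelope g lam (jointPoint x z) - h x) hf_cont
    (integrable_of_map_eq_withDensity hξ hf_cont.measurable hf_nonneg hf_density)
    (by simpa using hf_growth) hconv (by linarith) (by positivity) ?_ fun z => ?_
  · filter_upwards [hhD.bound, Metric.ball_mem_nhds x₀ one_pos] with x hx hx1 z
    rw [Metric.mem_ball, dist_eq_norm] at hx1
    have h1 := hLip (jointPoint x z) (jointPoint x₀ z)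
    rw [norm_jointPoint_sub_left] at h1
    have h2 := norm_jointPoint_le x z
    have h3 := norm_jointPoint_le x₀ z
    have h4 : ‖x‖ ≤ ‖x₀‖ + 1 := by linarith [norm_le_norm_add_norm_sub' x x₀]
    have h5 : 1 + ‖jointPoint x z‖ + ‖jointPoint x₀ z‖ ≤ (2 + 2 * ‖x₀‖) * (1 + ‖z‖) := by
      nlinarith [mul_nonneg (norm_nonneg x₀) (norm_nonneg z)]
    calc |moreauEnvelope g lam (jointPoint x z) - h x
          - (moreauEnvelope g lam (jointPoint x₀ z) - h x₀)|
        = |(moreauEnvelope g lam (jointPoint x z) - moreauEnvelope g lam (jointPoint x₀ z))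
          - (h x - h x₀)| := by congr 1; ring
      _ ≤ L * (1 + ‖jointPoint x z‖ + ‖jointPoint x₀ z‖) * ‖x - x₀‖ + D * ‖x - x₀‖ :=
          (abs_sub _ _).trans (add_le_add h1 hx)
      _ ≤ L * ((2 + 2 * ‖x₀‖) * (1 + ‖z‖)) * ‖x - x₀‖ + D * (1 + ‖z‖) * ‖x - x₀‖ := by
          gcongr
          nlinarith [norm_nonneg z]
      _ = _ := by ring
  · exact DifferentiableAt.sub
      (DifferentiableAt.comp (g := moreauEnvelope g lam)
        (f := fun q : H × EuclideanSpace ℝ (Fin m) => jointPoint q.1 q.2) _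
        (hSd _) (differentiable_jointPoint _))
      ((hh x₀).comp (x₀, z) differentiableAt_fst)

/-- The envelopes increase as `lam` decreases, so the events shrink to `{g ≤ h}`, and continuity of
the measure from above applies. -/
theorem tendsto_measureReal_moreauEnvelope (hξ : Measurable ξ) (hg : ConvexOn ℝ univ g) (x : H) :
    Tendsto (fun lam => P.real {ω | moreauEnvelope g lam (jointPoint x (ξ ω)) ≤ h x}) (𝓝[>] 0)
      (𝓝 (P.real {ω | g (jointPoint x (ξ ω)) ≤ h x})) := by
  have hjoint : Continuous fun z : EuclideanSpace ℝ (Fin m) => jointPoint x z :=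
    differentiable_jointPoint.continuous.comp (continuous_const.prodMk continuous_id)
  have hmeas : ∀ lam > 0,
      MeasurableSet {ω | moreauEnvelope g lam (jointPoint x (ξ ω)) ≤ h x} := fun lam hlam =>
    measurableSet_le ((((hg.differentiable_moreauEnvelope hlam).continuous.comp
      hjoint).measurable).comp hξ) measurable_const
  have hlim := tendsto_measure_biInter_gt (μ := P)
    (s := fun lam : ℝ => {ω | moreauEnvelope g lam (jointPoint x (ξ ω)) ≤ h x}) (a := 0)
    (fun lam hlam => (hmeas lam hlam).nullMeasurableSet)
    (fun i j hi hij ω hω => (hg.moreauEnvelope_anti hi hij _).trans hω)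
    ⟨1, one_pos, measure_ne_top _ _⟩
  have hinter : ⋂ lam : ℝ, ⋂ _ : lam > 0, {ω | moreauEnvelope g lam (jointPoint x (ξ ω)) ≤ h x}
      = {ω | g (jointPoint x (ξ ω)) ≤ h x} := by
    ext ω
    simp only [mem_iInter]
    refine ⟨fun H => ?_, fun H lam hlam => (hg.moreauEnvelope_le hlam _).trans H⟩
    refine le_of_tendsto (hg.tendsto_moreauEnvelope (jointPoint x (ξ ω))) ?_
    filter_upwards [self_mem_nhdsWithin] with lam hlam using H lam hlam
  rw [hinter] at hlim
  exact (ENNReal.tendsto_toReal (measure_ne_top _ _)).comp hlim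

end Probability

/-! ### Passage to the basic subdifferential and conclusion -/

/-- Outer approximation of the basic subdifferential when all regular subgradients near a point are
approximated by gradients with arbitrarily small parameters. -/
theorem basicSubdifferential_subset_outerLimit {H : Type*} [NormedAddCommGroup H]
    [InnerProductSpace ℝ H] [CompleteSpace H] {φ : H → ℝ} {ψ : ℝ → H → ℝ} {x : H}
    (happrox : ∀ᶠ u in 𝓝 x, ∀ s ∈ regularSubdifferential φ u, ∀ ε > 0, ∀ᶠ lam in 𝓝[>] (0 : ℝ),
      ∃ y g, HasGradientAt (ψ lam) g y ∧ ‖u - y‖ + ‖s - g‖ + |φ u - φ y| ≤ ε) :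
    basicSubdifferential φ x ⊆
      outerLimit (fun q : H × ℝ => gradientSet (ψ q.2) q.1) (𝓝 x ×ˢ 𝓝[>] (0 : ℝ)) := by
  rintro s₀ ⟨u, s, hs, hu, -, hs₀⟩
  obtain ⟨N, hN⟩ := eventually_atTop.1 (hu.eventually happrox)
  have hε : Tendsto (fun k : ℕ => 1 / ((k : ℝ) + 1)) atTop (𝓝 0) :=
    tendsto_one_div_add_atTop_nhds_zero_nat
  have hk : ∀ k : ℕ, ∃ (lam : ℝ) (y g : H), 0 < lam ∧ lam < 1 / ((k : ℝ) + 1) ∧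
      HasGradientAt (ψ lam) g y ∧
      ‖u (k + N) - y‖ + ‖s (k + N) - g‖ + |φ (u (k + N)) - φ y| ≤ 1 / ((k : ℝ) + 1) := by
    intro k
    have hpos : (0 : ℝ) < 1 / ((k : ℝ) + 1) := by positivity
    obtain ⟨lam, ⟨⟨y, g, h1, h2⟩, h3⟩⟩ := ((hN (k + N) (by lia) _ (hs _) _ hpos).and
      (Ioo_mem_nhdsGT hpos)).exists
    exact ⟨lam, y, g, h3.1, h3.2, h1, h2⟩
  choose lam y g hlam0 hlam1 hgrad hsum using hk
  have hnull : ∀ {a b : ℕ → H} {c : H}, Tendsto a atTop (𝓝 c) →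
      (∀ k, ‖a (k + N) - b k‖ ≤ 1 / ((k : ℝ) + 1)) → Tendsto b atTop (𝓝 c) := by
    intro a b c ha hab
    have h1 := squeeze_zero_norm hab hε
    simpa using ((tendsto_add_atTop_iff_nat N).2 ha).sub h1
  refine ⟨fun k => (y k, lam k), g, ?_, hgrad, ?_⟩
  · refine Tendsto.prodMk (hnull hu fun k => ?_) (tendsto_nhdsWithin_iff.2 ⟨?_, ?_⟩)
    · linarith [hsum k, norm_nonneg (s (k + N) - g k), abs_nonneg (φ (u (k + N)) - φ (y k))]
    · exact squeeze_zero (fun k => (hlam0 k).le) (fun k => (hlam1 k).le) hε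
    · exact Eventually.of_forall hlam0
  · refine hnull hs₀ fun k => ?_
    linarith [hsum k, norm_nonneg (u (k + N) - y k), abs_nonneg (φ (u (k + N)) - φ (y k))]

theorem mainTheorem10
    {H : Type*} [NormedAddCommGroup H] [InnerProductSpace ℝ H] [CompleteSpace H]
    [FiniteDimensional ℝ H]
    {Y : Type*} [NormedAddCommGroup Y] [NormedSpace ℝ Y] [CompleteSpace Y]
    {Ω : Type*} [MeasurableSpace Ω] (P : Measure Ω) [IsProbabilityMeasure P]
    {m : ℕ}
    -- the random vector and its continuous density
    (ξ : Ω → EuclideanSpace ℝ (Fin m)) (hξ : Measurable ξ)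
    (f : EuclideanSpace ℝ (Fin m) → ℝ) (hf_cont : Continuous f) (hf_nonneg : ∀ z, 0 ≤ f z)
    (hf_density : P.map ξ = volume.withDensity (fun z => ENNReal.ofReal (f z)))
    -- the convex cone and the set of scalarizing functionals
    (K : ConvexCone ℝ Y) (hK_nonempty : (K : Set Y).Nonempty)
    (hK : IsClosed (K : Set Y) ∨ (interior (K : Set Y)).Nonempty)
    (C : Set (WeakDual ℝ Y)) (hC_compact : IsCompact C) (hC_convex : Convex ℝ C)
    (hC_generates : closure (generatedCone C) = positivePolar (K : Set Y))
    -- the constraint mapping and the convexity of its scalarizations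
    (Φ : JointSpace H m → Y)
    (h : H → ℝ) (hh_smooth : ContDiff ℝ 1 h) (hh_convex : ConvexOn ℝ univ h)
    (hΦ : ∀ v ∈ C, ConvexOn ℝ univ (fun p : JointSpace H m => v (Φ p) + h p.fst))
    -- the Slater point and the growth condition on the density
    (xbar : H) (hxbar : supremumFunction Φ C h (jointPoint xbar 0) < h xbar)
    (hf_growth : Tendsto (fun z => ‖z‖ ^ (m + 1) * f z)
      (Bornology.cobounded (EuclideanSpace ℝ (Fin m))) (𝓝 0)) :
    (∀ s ∈ regularSubdifferential (probabilityFunction P ξ Φ K) xbar, ∀ ε : ℝ, 0 < ε →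
      ∃ (lam : ℝ) (x g : H), 0 < lam ∧
        HasGradientAt (regularizedProbability P ξ Φ C h lam) g x ∧
        ‖xbar - x‖ + ‖s - g‖ +
          |probabilityFunction P ξ Φ K xbar - probabilityFunction P ξ Φ K x| ≤ ε) ∧
    basicSubdifferential (probabilityFunction P ξ Φ K) xbar ⊆
      outerLimit (fun q : H × ℝ => gradientSet (regularizedProbability P ξ Φ C h q.2) q.1)
        (𝓝 xbar ×ˢ 𝓝[>] (0 : ℝ)) := by
  have hS : ConvexOn ℝ univ (supremumFunction Φ C h) :=
    convexOn_supremumFunction hC_compact (nonempty_of_closure_generatedCone hC_generates) hΦ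
  have hh : Differentiable ℝ h := hh_smooth.differentiable one_ne_zero
  have hjoint : Continuous fun x : H => jointPoint x (0 : EuclideanSpace ℝ (Fin m)) :=
    differentiable_jointPoint.continuous.comp (continuous_id.prodMk continuous_const)
  -- Openness of the Slater set makes the approximation available at all points near `xbar`, as
  -- limits of subgradients at nearby points require.
  have hopen : IsOpen {x | supremumFunction Φ C h (jointPoint x 0) < h x} :=
    isOpen_lt (hS.locallyLipschitz.continuous.comp hjoint) hh.continuous
  have happrox : ∀ u ∈ {x | supremumFunction Φ C h (jointPoint x 0) < h x},
      ∀ s ∈ regularSubdifferential (probabilityFunction P ξ Φ K) u, ∀ ε > 0,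
      ∀ᶠ lam in 𝓝[>] (0 : ℝ), ∃ y g, HasGradientAt (regularizedProbability P ξ Φ C h lam) g y ∧
        ‖u - y‖ + ‖s - g‖ +
          |probabilityFunction P ξ Φ K u - probabilityFunction P ξ Φ K y| ≤ ε := by
    intro u hu s hs ε hε
    obtain ⟨δ, hδ, hball⟩ := Metric.isOpen_iff.1 hopen u hu
    refine eventually_exists_hasGradientAt hs ?_ ?_ hδ ?_ hε
    · filter_upwards [self_mem_nhdsWithin] with lam hlam y
      exact measureReal_mono fun ω hω => (hS.moreauEnvelope_le hlam _).trans
        (supremumFunction_le_of_mem hC_generates hω)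
    · rw [probabilityFunction_eq_measureReal hξ hf_density hS
        (fun p hp => supremumFunction_le_of_mem hC_generates hp)
        (fun p hp => mem_of_supremumFunction_lt hK_nonempty hK hC_compact hC_generates hp) hu]
      exact tendsto_measureReal_moreauEnvelope hξ hS u
    · filter_upwards [self_mem_nhdsWithin] with lam hlam y hy
      exact differentiableAt_measureReal_moreauEnvelope hξ hf_cont hf_nonneg hf_density hf_growth
        hS hh hlam (hball hy)
  refine ⟨fun s hs ε hε => ?_, basicSubdifferential_subset_outerLimit ?_⟩
  · obtain ⟨lam, ⟨y, g, hg, hle⟩, hlam⟩ :=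
      ((happrox xbar hxbar s hs ε hε).and self_mem_nhdsWithin).exists
    exact ⟨lam, y, g, hlam, hg, hle⟩
  · filter_upwards [hopen.mem_nhds hxbar] with u hu using happrox u hu
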